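/- **Proposition 3.3.** Over $I\Sigma_1$ the following statements are equivalent: 1. $I\Sigma_2$; 2. if $T$ is a $\emptyset'$-computable binary tree with $\mu([T])>0$ and $\epsilon>0$, then there is a string $\sigma$ with $\mu([T_\sigma])>(1-\epsilon)2^{-|\sigma|}$. That is, for every model $M$ of $PA^-+I\Sigma_1$, $M\models I\Sigma_2$ if and only if (2) holds in $M$, where everything is understood in the sense of $M$: strings are the $M$-finite binary strings; a tree is a set $T\subseteq M$ of strings closed under initial segments; $T_\sigma=\{\tau\in T:\tau \text{ is comparable with }\sigma\}$; a set is computably enumerable if it is $\Sigma_1$-definable in $M$ with parameters, and $\emptyset'$-computable if it is Turing computable, by a functional of $M$, from the complete computably enumerable set $\emptyset'$ (equivalently, from some computably enumerable set); $\epsilon$ ranges over the positive rationals of $M$; and $\mu([T])=\inf_l |T\cap 2^l|\,2^{-l}$, so that $\mu([T])>q$ means that there is a rational $r>q$ of $M$ such that for every $l\in M$ the set $T\cap 2^l$ has at least $r2^l$ elements (that is, it contains an $M$-finite set with at least $r2^l$ elements). -/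

import Mathlib

universe u

/-- `M` is a model of `PA⁻`: the nonnegative part of a discretely ordered commutative ring.
`CanonicallyOrderedAdd` says that `x ≤ y` iff `y = x + z` for some `z`; in particular all elements
are nonnegative. -/
class PAMinus (M : Type u) [CommSemiring M] [LinearOrder M] : Prop extends
    IsStrictOrderedRing M, CanonicallyOrderedAdd M where
  one_le_of_pos : ∀ x : M, 0 < x → 1 ≤ x

namespace Arith

section Hierarchy

variable {M : Type u} [CommSemiring M] [LinearOrder M]

/-- The relations on `M` that are defined by a `Δ₀` (bounded) formula with parameters from `M`.
Terms with parameters are polynomials with coefficients in `M`; the clauses follow the formation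
rules of bounded formulas. In the quantifier clauses the quantified variable becomes variable `0`
and the bound does not contain it. -/
inductive IsDelta0 : {n : ℕ} → ((Fin n → M) → Prop) → Prop
  | eq {n : ℕ} (p q : MvPolynomial (Fin n) M) :
      IsDelta0 fun x : Fin n → M => MvPolynomial.eval x p = MvPolynomial.eval x q
  | lt {n : ℕ} (p q : MvPolynomial (Fin n) M) :
      IsDelta0 fun x : Fin n → M => MvPolynomial.eval x p < MvPolynomial.eval x q
  | not {n : ℕ} {R : (Fin n → M) → Prop} : IsDelta0 R → IsDelta0 fun x => ¬ R x
  | and {n : ℕ} {R S : (Fin n → M) → Prop} :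
      IsDelta0 R → IsDelta0 S → IsDelta0 fun x => R x ∧ S x
  | or {n : ℕ} {R S : (Fin n → M) → Prop} :
      IsDelta0 R → IsDelta0 S → IsDelta0 fun x => R x ∨ S x
  | ball {n : ℕ} (t : MvPolynomial (Fin n) M) {R : (Fin (n + 1) → M) → Prop} :
      IsDelta0 R → IsDelta0 fun x : Fin n → M =>
        ∀ y : M, y < MvPolynomial.eval x t → R (Fin.cons y x)
  | bex {n : ℕ} (t : MvPolynomial (Fin n) M) {R : (Fin (n + 1) → M) → Prop} :
      IsDelta0 R → IsDelta0 fun x : Fin n → M =>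
        ∃ y : M, y < MvPolynomial.eval x t ∧ R (Fin.cons y x)

/-- The relations on `M` that are defined by a `Σₖ` formula with parameters from `M`: `Σ₀ = Δ₀`,
and a `Σₖ₊₁` formula is `∃ y, φ` with `φ` the negation of a `Σₖ` formula, that is, `φ` in `Πₖ`. -/
def IsSigma : ℕ → {n : ℕ} → ((Fin n → M) → Prop) → Prop
  | 0, _, R => IsDelta0 R
  | k + 1, n, R => ∃ S : (Fin (n + 1) → M) → Prop, IsSigma k S ∧
      ∀ x : Fin n → M, R x ↔ ∃ y : M, ¬ S (Fin.cons y x)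

/-- `A ⊆ M` is `Σₖ`-definable in `M`, with parameters. -/
def IsSigmaSet (k : ℕ) (A : Set M) : Prop :=
  IsSigma k fun x : Fin 1 → M => x 0 ∈ A

variable (M) in
/-- The induction scheme for `Σₖ` formulas (with parameters) holds in `M`. For a model `M` of `PA⁻`
this is `M ⊨ IΣₖ`. -/
def ISigma (k : ℕ) : Prop :=
  ∀ A : Set M, IsSigmaSet k A → 0 ∈ A → (∀ x, x ∈ A → x + 1 ∈ A) → ∀ x, x ∈ A

/-- `A ⊆ M` is computably enumerable in the sense of `M`. -/
def IsCE (A : Set M) : Prop := IsSigmaSet 1 A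

end Hierarchy

section Coding

variable {M : Type u} [CommSemiring M] [LinearOrder M]

/-- Gödel's `β` function: `v` is the remainder of `a` modulo `1 + (i + 1) b`. The pair `(a, b)`
codes an `M`-finite sequence, with `v` as its entry at place `i`. -/
def Beta (a b i v : M) : Prop :=
  v < 1 + (i + 1) * b ∧ ∃ q : M, a = q * (1 + (i + 1) * b) + v

/-- `p = 2 ^ n` in the sense of `M`: there is an `M`-finite sequence `1, 2, 4, …` whose entry at
place `n` is `p`. -/
def IsTwoPow (n p : M) : Prop :=
  ∃ a b : M, Beta a b 0 1 ∧ (∀ i < n, ∃ v : M, Beta a b i v ∧ Beta a b (i + 1) (2 * v)) ∧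
    Beta a b n p

/-- `A` has at least `k` elements in the sense of `M`: some `M`-finite sequence of length `k`
enumerates elements of `A` without repetition. -/
def HasAtLeast (A : Set M) (k : M) : Prop :=
  ∃ a b : M, (∀ i < k, ∃ x ∈ A, Beta a b i x) ∧
    ∀ i < k, ∀ j < k, ∀ x : M, Beta a b i x → Beta a b j x → i = j

end Coding

section Computability

variable {M : Type u} [CommSemiring M] [LinearOrder M]

/-- `(a, b)` codes the characteristic string of length `u` of the set `Y`. -/
def CodesOracle (Y : Set M) (a b u : M) : Prop :=
  ∀ i < u, (i ∈ Y ∧ Beta a b i 1) ∨ (i ∉ Y ∧ Beta a b i 0)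

/-- `X` is computable from the oracle `Y` in the sense of `M`. A functional is given by a computably
enumerable set `Φ` of axioms `(x, j, ρ)`: on input `x` and any oracle that extends the finite string
`ρ`, the output is `j`. Here `ρ` is the string of length `u` coded by `(a, b)`. -/
def IsComputableIn (X Y : Set M) : Prop :=
  ∃ Φ : (Fin 5 → M) → Prop, IsSigma 1 Φ ∧ ∀ x : M,
    (x ∈ X ↔ ∃ a b u : M, CodesOracle Y a b u ∧ Φ ![x, 1, a, b, u]) ∧
    (x ∉ X ↔ ∃ a b u : M, CodesOracle Y a b u ∧ Φ ![x, 0, a, b, u])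

/-- `X` is `∅'`-computable in the sense of `M`. As `∅'` is the complete computably enumerable set
(every computably enumerable set is many-one reducible to it), this says that `X` is computable from
some computably enumerable oracle. -/
def IsZeroJumpComputable (X : Set M) : Prop :=
  ∃ Y : Set M, IsCE Y ∧ IsComputableIn X Y

end Computability

section Trees

variable {M : Type u} [CommSemiring M] [LinearOrder M]

/-! The binary strings of `M` are coded by the positive elements of `M`: the string `b₀ b₁ … bₙ₋₁`
is the number with binary expansion `1 b₀ b₁ … bₙ₋₁`; the empty string is `1`. -/

/-- `s` is a string of length `n`. -/
def HasLength (s n : M) : Prop :=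
  ∃ p : M, IsTwoPow n p ∧ p ≤ s ∧ s < 2 * p

/-- The string `s` is an initial segment of the string `t`. -/
def IsPrefix (s t : M) : Prop :=
  ∃ k p r : M, IsTwoPow k p ∧ r < p ∧ t = s * p + r

/-- `T` is a binary tree: a set of strings that is closed under initial segments. -/
def IsTree (T : Set M) : Prop :=
  (∀ t ∈ T, 0 < t) ∧ ∀ s t : M, 0 < s → IsPrefix s t → t ∈ T → s ∈ T

/-- `T_σ`: the elements of `T` that are comparable with `σ`. -/
def restrict (T : Set M) (σ : M) : Set M :=
  {t ∈ T | IsPrefix t σ ∨ IsPrefix σ t}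

/-- The strings in `T` of length `l`. -/
def level (T : Set M) (l : M) : Set M :=
  {t ∈ T | HasLength t l}

/-- `μ([T]) ≥ c / d`, for a tree `T` and `d > 0`: as `μ([T]) = inf_l |T ∩ 2^l| / 2^l`, this says
that `|T ∩ 2^l| ≥ (c / d) 2^l` for all `l`. -/
def MeasureGE (T : Set M) (c d : M) : Prop :=
  ∀ l p : M, IsTwoPow l p → ∃ k : M, HasAtLeast (level T l) k ∧ c * p ≤ k * d

/-- `μ([T]) > 0`: some positive rational `c / d` of `M` is a lower bound of the measure. -/
def MeasurePos (T : Set M) : Prop :=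
  ∃ c d : M, 0 < c ∧ 0 < d ∧ MeasureGE T c d

/-- `μ([T_σ]) > (1 - ε) 2^{-|σ|}` for `ε = e / f`, where `f > 0`: there is a rational `c / d` of `M`
with `μ([T_σ]) ≥ c / d` and `c / d > (1 - ε) 2^{-|σ|}`, the latter written without subtraction as
`f d < c 2^{|σ|} f + e d`. -/
def DenseAt (T : Set M) (σ e f : M) : Prop :=
  ∃ n p c d : M, HasLength σ n ∧ IsTwoPow n p ∧ 0 < d ∧ f * d < c * p * f + e * d ∧
    MeasureGE (restrict T σ) c d

variable (M) in
/-- Lebesgue density for `∅'`-computable trees, in the sense of `M`: for every `∅'`-computable binary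
tree `T` with `μ([T]) > 0` and every rational `ε = e / f > 0` of `M` there is a string `σ` with
`μ([T_σ]) > (1 - ε) 2^{-|σ|}`. -/
def LebesgueDensity : Prop :=
  ∀ T : Set M, IsTree T → IsZeroJumpComputable T → MeasurePos T →
    ∀ e f : M, 0 < e → 0 < f → ∃ σ : M, 0 < σ ∧ DenseAt T σ e f

end Trees

end Arith

/-! Since the string `b₀ … bₙ₋₁` is the number `1 b₀ … bₙ₋₁` in binary, level `l` of a tree lies in
the interval `[2^l, 2^(l+1))`, and the extensions of `σ` by `m` bits form `[σ 2^m, (σ+1) 2^m)`.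
Measures are therefore handled through the counting function `C x = |T ∩ [0, x)|`.

From `IΣ₂` to density (`exists_denseAt_of_le`): a `∅'`-computable tree is `Δ₂`, so `IΣ₂` supplies
`C`. The least number principle gives a level `n` whose density exceeds a common lower bound of all
level densities by less than a prescribed fraction. If no `σ` of length `n` were dense, then above
each `σ` some later level would contain at most a proportion `1 - ε/2` of the possible strings when
`σ ∈ T`, and none otherwise. This persists at still later levels (`Sparse.mono`), so an induction
along level `n` finds one `m` that serves for all `σ` at once. Level `n + m` would then have at most
`1 - ε/2` times the density of level `n`, which is below the common lower bound.

From density to `IΣ₂` (`iSigma_two_of_lebesgueDensity`): if `IΣ₂` fails, there is a `Π₁` set `D`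
that is unbounded and yet has at most `c + 1` elements below any bound
(`exists_unbounded_set_of_not_iSigma`). The tree of strings vanishing on `D` is `∅'`-computable and
has measure at least `2^-(c+1)`. But beyond every `σ` lies another place of `D`, where at least half
of the extensions of `σ` are lost, so density fails for `ε = 1/2`.

The rest develops arithmetic inside `M`: closure of `Σₖ` under bounded quantifiers, coding of
sequences, recursion, exponentiation and finite cardinality. -/

/-! ### Embedding of `M` into an ordered commutative ring, where subtraction and ring-based
arithmetic tactics are available. -/

section DifferenceRing

variable (M : Type u) [CommSemiring M] [LinearOrder M] [PAMinus M]

/-- Two formal differences are equal when their cross sums agree. -/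
def diffSetoid : Setoid (M × M) where
  r x y := x.1 + y.2 = y.1 + x.2
  iseqv := by
    refine ⟨fun _ => rfl, fun h => h.symm, fun {x y z} h₁ h₂ => ?_⟩
    have : x.1 + z.2 + y.2 = z.1 + x.2 + y.2 := by
      calc x.1 + z.2 + y.2 = (x.1 + y.2) + z.2 := by ring
        _ = (y.1 + z.2) + x.2 := by rw [h₁]; ring
        _ = z.1 + x.2 + y.2 := by rw [h₂]; ring
    exact add_right_cancel this

/-- The ordered ring of differences of elements of `M`. -/
def Diff : Type u := Quotient (diffSetoid M)

namespace Diff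

variable {M}

/-- The difference `a - b`. -/
def mk (a b : M) : Diff M := Quotient.mk (diffSetoid M) (a, b)

lemma mk_eq {a b c d : M} : mk a b = mk c d ↔ a + d = c + b :=
  ⟨fun h => Quotient.exact h, fun h => Quotient.sound h⟩

lemma ind {P : Diff M → Prop} (h : ∀ a b, P (mk a b)) (x : Diff M) : P x :=
  Quotient.inductionOn x fun y => h y.1 y.2

instance : Add (Diff M) where
  add := Quotient.map₂ (fun x y => (x.1 + y.1, x.2 + y.2)) (by
    intro x x' h y y' h'
    change x.1 + y.1 + (x'.2 + y'.2) = x'.1 + y'.1 + (x.2 + y.2)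
    calc _ = (x.1 + x'.2) + (y.1 + y'.2) := by ring
      _ = (x'.1 + x.2) + (y'.1 + y.2) := by rw [show _ = _ from h, show _ = _ from h']
      _ = _ := by ring)

instance : Mul (Diff M) where
  mul := Quotient.map₂ (fun x y => (x.1 * y.1 + x.2 * y.2, x.1 * y.2 + x.2 * y.1)) (by
    rintro ⟨a, b⟩ ⟨a', b'⟩ h ⟨c, d⟩ ⟨c', d'⟩ h'
    change a + b' = a' + b at h
    change c + d' = c' + d at h'
    change a * c + b * d + (a' * d' + b' * c') = a' * c' + b' * d' + (a * d + b * c)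
    have key : a * c + b * d + (a' * d' + b' * c') + (b' * c + a' * d)
        = a' * c' + b' * d' + (a * d + b * c) + (b' * c + a' * d) := by
      calc _ = (a + b') * c + (a' + b) * d + a' * d' + b' * c' := by ring
        _ = (a' + b) * c + (a + b') * d + a' * d' + b' * c' := by rw [h]
        _ = a' * (c + d') + b' * (c' + d) + (b * c + a * d) := by ring
        _ = a' * (c' + d) + b' * (c + d') + (b * c + a * d) := by rw [h']
        _ = _ := by ring
    exact add_right_cancel key)

instance : Neg (Diff M) where
  neg := Quotient.map (fun x => (x.2, x.1)) (by
    intro x y h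
    change x.2 + y.1 = y.2 + x.1
    rw [add_comm x.2, add_comm y.2]; exact h.symm)

instance : Zero (Diff M) := ⟨mk 0 0⟩

instance : One (Diff M) := ⟨mk 1 0⟩

lemma mk_add (a b c d : M) : mk a b + mk c d = mk (a + c) (b + d) := rfl

lemma mk_mul (a b c d : M) : mk a b * mk c d = mk (a * c + b * d) (a * d + b * c) := rfl

lemma neg_mk (a b : M) : -mk a b = mk b a := rfl

lemma zero_def : (0 : Diff M) = mk 0 0 := rfl

lemma one_def : (1 : Diff M) = mk 1 0 := rfl

instance : CommRing (Diff M) where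
  add_assoc x y z := by
    induction x using ind; induction y using ind; induction z using ind
    simp only [mk_add, mk_eq]; ring
  zero_add x := by induction x using ind; simp only [zero_def, mk_add, mk_eq]; ring
  add_zero x := by induction x using ind; simp only [zero_def, mk_add, mk_eq]; ring
  add_comm x y := by
    induction x using ind; induction y using ind
    simp only [mk_add, mk_eq]; ring
  left_distrib x y z := by
    induction x using ind; induction y using ind; induction z using ind
    simp only [mk_add, mk_mul, mk_eq]; ring
  right_distrib x y z := by
    induction x using ind; induction y using ind; induction z using ind
    simp only [mk_add, mk_mul, mk_eq]; ring
  zero_mul x := by induction x using ind; simp only [zero_def, mk_mul, mk_eq]; ring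
  mul_zero x := by induction x using ind; simp only [zero_def, mk_mul, mk_eq]; ring
  mul_assoc x y z := by
    induction x using ind; induction y using ind; induction z using ind
    simp only [mk_mul, mk_eq]; ring
  one_mul x := by induction x using ind; simp only [one_def, mk_mul, mk_eq]; ring
  mul_one x := by induction x using ind; simp only [one_def, mk_mul, mk_eq]; ring
  mul_comm x y := by
    induction x using ind; induction y using ind
    simp only [mk_mul, mk_eq]; ring
  neg_add_cancel x := by
    induction x using ind; simp only [zero_def, neg_mk, mk_add, mk_eq]; ring
  nsmul := nsmulRec
  zsmul := zsmulRec

instance : LE (Diff M) where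
  le := Quotient.lift₂ (fun x y => x.1 + y.2 ≤ y.1 + x.2) (by
    have key : ∀ x x' y y' : M × M, x.1 + x'.2 = x'.1 + x.2 → y.1 + y'.2 = y'.1 + y.2 →
        x.1 + y.2 ≤ y.1 + x.2 → x'.1 + y'.2 ≤ y'.1 + x'.2 := by
      rintro ⟨a, b⟩ ⟨a', b'⟩ ⟨c, d⟩ ⟨c', d'⟩ h h' h₁
      dsimp only at *
      grind
    intro x y x' y' h h'
    exact propext ⟨key x x' y y' h h', key x' x y' y (Eq.symm h) (Eq.symm h')⟩)

lemma mk_le {a b c d : M} : mk a b ≤ mk c d ↔ a + d ≤ c + b := Iff.rfl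

noncomputable instance : LinearOrder (Diff M) where
  le_refl x := by induction x using ind; simp only [mk_le]; rfl
  le_trans x y z := by
    induction x using ind; induction y using ind; induction z using ind
    simp only [mk_le]; grind
  le_antisymm x y := by
    induction x using ind; induction y using ind
    simp only [mk_le, mk_eq]; exact le_antisymm
  le_total x y := by
    induction x using ind; induction y using ind
    simp only [mk_le]; exact le_total _ _
  toDecidableLE := Classical.decRel _

lemma mk_lt {a b c d : M} : mk a b < mk c d ↔ a + d < c + b := by
  rw [← not_le, mk_le, not_le]

instance : Nontrivial (Diff M) := ⟨0, 1, by simp [zero_def, one_def, mk_eq]⟩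

instance : IsOrderedAddMonoid (Diff M) where
  add_le_add_left x y h z := by
    induction x using ind; induction y using ind; induction z using ind
    simp only [mk_le, mk_add] at *; grind

instance : ZeroLEOneClass (Diff M) := ⟨by simp [zero_def, one_def, mk_le]⟩

instance : IsStrictOrderedRing (Diff M) :=
  IsStrictOrderedRing.of_mul_pos fun x y => by
    induction x using ind with | h a b => ?_
    induction y using ind with | h c d => ?_
    simp only [mk_lt, zero_def, mk_mul, zero_add, add_zero]
    intro hb hd
    obtain ⟨e, rfl⟩ := exists_add_of_le hb.le
    obtain ⟨g, rfl⟩ := exists_add_of_le hd.le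
    have : 0 < e * g := mul_pos (by grind) (by grind)
    calc (b + e) * d + b * (d + g) = (b + e) * d + b * (d + g) + 0 := by ring
      _ < (b + e) * d + b * (d + g) + e * g := by gcongr
      _ = _ := by ring

/-- The inclusion of `M` into its ring of differences. -/
def of : M →+* Diff M where
  toFun a := mk a 0
  map_zero' := rfl
  map_one' := rfl
  map_add' a b := by simp only [mk_add, mk_eq]; ring
  map_mul' a b := by simp only [mk_mul, mk_eq]; ring

lemma of_inj (a b : M) : a = b ↔ of a = of b := by
  change _ ↔ mk _ _ = mk _ _; simp [mk_eq]

lemma of_le (a b : M) : a ≤ b ↔ of a ≤ of b := by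
  change _ ↔ mk _ _ ≤ mk _ _; simp [mk_le]

lemma of_lt (a b : M) : a < b ↔ of a < of b := by
  change _ ↔ mk _ _ < mk _ _; simp [mk_lt]

lemma of_nonneg (a : M) : 0 ≤ of a := by
  rw [← map_zero of, ← of_le]; exact zero_le

end Diff

end DifferenceRing

namespace Arith

/-! ### Closure properties of the `Σₖ` relations. -/

section Definability

variable {M : Type u} [CommSemiring M]

/-- The functions that are given by a polynomial with coefficients in `M`. -/
def PolyFun {n : ℕ} (f : (Fin n → M) → M) : Prop :=
  ∃ p : MvPolynomial (Fin n) M, ∀ x, MvPolynomial.eval x p = f x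

namespace PolyFun

variable {n m : ℕ} {f g : (Fin n → M) → M}

lemma coord (i : Fin n) : PolyFun fun x : Fin n → M => x i :=
  ⟨MvPolynomial.X i, fun x => by simp⟩

lemma const (a : M) : PolyFun fun _ : Fin n → M => a :=
  ⟨MvPolynomial.C a, fun x => by simp⟩

lemma add (hf : PolyFun f) (hg : PolyFun g) : PolyFun fun x => f x + g x := by
  obtain ⟨p, hp⟩ := hf
  obtain ⟨q, hq⟩ := hg
  exact ⟨p + q, fun x => by simp [hp, hq]⟩

lemma mul (hf : PolyFun f) (hg : PolyFun g) : PolyFun fun x => f x * g x := by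
  obtain ⟨p, hp⟩ := hf
  obtain ⟨q, hq⟩ := hg
  exact ⟨p * q, fun x => by simp [hp, hq]⟩

lemma comp (hf : PolyFun f) {F : (Fin m → M) → Fin n → M} (hF : ∀ i, PolyFun fun x => F x i) :
    PolyFun fun x => f (F x) := by
  obtain ⟨p, hp⟩ := hf
  simp only [← hp]
  clear hp
  induction p using MvPolynomial.induction_on with
  | C a => simpa using const a
  | add p q ihp ihq => simpa using ihp.add ihq
  | mul_X p i ih => simpa using ih.mul (hF i)

lemma cons {F : (Fin m → M) → Fin n → M} (hF : ∀ i, PolyFun fun x => F x i) (i : Fin (n + 1)) :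
    PolyFun fun x : Fin (m + 1) → M => (Fin.cons (x 0) (F (Fin.tail x)) : Fin (n + 1) → M) i := by
  refine Fin.cases ?_ (fun i => ?_) i
  · exact coord 0
  · exact (hF i).comp (F := Fin.tail) fun j => coord j.succ

end PolyFun

variable [LinearOrder M]

namespace IsDelta0

variable {n m : ℕ}

lemma eq_of_poly {f g : (Fin n → M) → M} (hf : PolyFun f) (hg : PolyFun g) :
    IsDelta0 fun x => f x = g x := by
  obtain ⟨p, hp⟩ := hf
  obtain ⟨q, hq⟩ := hg
  simpa only [hp, hq] using IsDelta0.eq p q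

lemma lt_of_poly {f g : (Fin n → M) → M} (hf : PolyFun f) (hg : PolyFun g) :
    IsDelta0 fun x => f x < g x := by
  obtain ⟨p, hp⟩ := hf
  obtain ⟨q, hq⟩ := hg
  simpa only [hp, hq] using IsDelta0.lt p q

lemma subst {R : (Fin n → M) → Prop} (h : IsDelta0 R) {F : (Fin m → M) → Fin n → M}
    (hF : ∀ i, PolyFun fun x => F x i) : IsDelta0 fun x => R (F x) := by
  induction h generalizing m with
  | eq p q => exact eq_of_poly (.comp ⟨p, fun _ => rfl⟩ hF) (.comp ⟨q, fun _ => rfl⟩ hF)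
  | lt p q => exact lt_of_poly (.comp ⟨p, fun _ => rfl⟩ hF) (.comp ⟨q, fun _ => rfl⟩ hF)
  | not _ ih => exact .not (ih hF)
  | and _ _ ih₁ ih₂ => exact .and (ih₁ hF) (ih₂ hF)
  | or _ _ ih₁ ih₂ => exact .or (ih₁ hF) (ih₂ hF)
  | ball t _ ih =>
    obtain ⟨p, hp⟩ := PolyFun.comp ⟨t, fun _ => rfl⟩ hF
    simpa [hp] using IsDelta0.ball p (ih (PolyFun.cons hF))
  | bex t _ ih =>
    obtain ⟨p, hp⟩ := PolyFun.comp ⟨t, fun _ => rfl⟩ hF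
    simpa [hp] using IsDelta0.bex p (ih (PolyFun.cons hF))

end IsDelta0

variable (M) in
/-- The closure properties of the `Σₖ` relations on `M`. -/
class Closed (k : ℕ) : Prop where
  subst {m n : ℕ} {R : (Fin n → M) → Prop} (_ : IsSigma k R) {F : (Fin m → M) → Fin n → M}
    (_ : ∀ i, PolyFun fun x => F x i) : IsSigma k fun x => R (F x)
  and {n : ℕ} {R S : (Fin n → M) → Prop} (_ : IsSigma k R) (_ : IsSigma k S) :
    IsSigma k fun x => R x ∧ S x
  or {n : ℕ} {R S : (Fin n → M) → Prop} (_ : IsSigma k R) (_ : IsSigma k S) :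
    IsSigma k fun x => R x ∨ S x
  ball_poly {n : ℕ} {t : (Fin n → M) → M} (_ : PolyFun t) {R : (Fin n → M) → M → Prop}
    (_ : IsSigma k fun x : Fin (n + 1) → M => R (Fin.tail x) (x 0)) :
    IsSigma k fun x => ∀ y, y < t x → R x y
  bex_poly {n : ℕ} {t : (Fin n → M) → M} (_ : PolyFun t) {R : (Fin n → M) → M → Prop}
    (_ : IsSigma k fun x : Fin (n + 1) → M => R (Fin.tail x) (x 0)) :
    IsSigma k fun x => ∃ y, y < t x ∧ R x y
  ex (_ : 0 < k) {n : ℕ} {R : (Fin n → M) → M → Prop}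
    (_ : IsSigma k fun x : Fin (n + 1) → M => R (Fin.tail x) (x 0)) :
    IsSigma k fun x => ∃ y, R x y

lemma closed_zero : Closed M 0 where
  subst := IsDelta0.subst
  and := .and
  or := .or
  ball_poly {n t} ht R h := by
    obtain ⟨p, hp⟩ := ht
    have := IsDelta0.ball p h
    simp only [hp, Fin.cons_zero, Fin.tail_cons] at this
    exact this
  bex_poly {n t} ht R h := by
    obtain ⟨p, hp⟩ := ht
    have := IsDelta0.bex p h
    simp only [hp, Fin.cons_zero, Fin.tail_cons] at this
    exact this
  ex h := absurd h (lt_irrefl 0)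

/-- Moves the negation into the hypothesis on the matrix, so that `R` is a plain existential over a
`Πₖ` relation `S`. -/
lemma isSigma_succ_iff {k n : ℕ} {R : (Fin n → M) → Prop} :
    IsSigma (k + 1) R ↔ ∃ S : (Fin n → M) → M → Prop,
      IsSigma k (fun x : Fin (n + 1) → M => ¬ S (Fin.tail x) (x 0)) ∧ R = fun x => ∃ y, S x y := by
  constructor
  · rintro ⟨S, hS, h⟩
    refine ⟨fun x y => ¬ S (Fin.cons y x), ?_, funext fun x => propext (h x)⟩
    simpa using hS
  · rintro ⟨S, hS, rfl⟩
    exact ⟨_, hS, fun x => by simp⟩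

lemma IsSigma.succ {k n : ℕ} {R : (Fin n → M) → Prop} (h : IsSigma k R) : IsSigma (k + 1) R := by
  induction k generalizing n with
  | zero =>
    refine isSigma_succ_iff.2 ⟨fun x _ => R x, ?_, by simp⟩
    exact (IsDelta0.not h).subst (F := Fin.tail) fun i => PolyFun.coord i.succ
  | succ k ih =>
    obtain ⟨S, hS, rfl⟩ := isSigma_succ_iff.1 h
    exact isSigma_succ_iff.2 ⟨S, ih hS, rfl⟩

lemma IsDelta0.isSigma {n : ℕ} {R : (Fin n → M) → Prop} (h : IsDelta0 R) (k : ℕ) :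
    IsSigma k R := by
  induction k with
  | zero => exact h
  | succ k ih => exact ih.succ

lemma IsSigma.not_succ {k n : ℕ} [Closed M k] {R : (Fin n → M) → Prop} (h : IsSigma k R) :
    IsSigma (k + 1) fun x => ¬ R x := by
  refine isSigma_succ_iff.2 ⟨fun x _ => ¬ R x, ?_, by simp⟩
  simpa only [not_not] using Closed.subst h (F := Fin.tail) fun i => PolyFun.coord i.succ

section Succ

variable {k n : ℕ} [hc : Closed M k]

lemma isSigma_not_bex {t : (Fin n → M) → M} (ht : PolyFun t) {R : (Fin n → M) → M → Prop}
    (h : IsSigma k fun x : Fin (n + 1) → M => ¬ R (Fin.tail x) (x 0)) :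
    IsSigma k fun x => ¬ ∃ y, y < t x ∧ R x y := by
  simpa using Closed.ball_poly ht (R := fun x y => ¬ R x y) h

lemma isSigma_not_ball {t : (Fin n → M) → M} (ht : PolyFun t) {R : (Fin n → M) → M → Prop}
    (h : IsSigma k fun x : Fin (n + 1) → M => ¬ R (Fin.tail x) (x 0)) :
    IsSigma k fun x => ¬ ∀ y, y < t x → R x y := by
  simpa using Closed.bex_poly ht (R := fun x y => ¬ R x y) h

lemma isSigma_permute {R : (Fin n → M) → M → M → Prop}
    (h : IsSigma k fun x : Fin (n + 2) → M => ¬ R (Fin.tail (Fin.tail x)) (Fin.tail x 0) (x 0)) :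
    IsSigma k fun x : Fin (n + 2 + 1) → M =>
      ¬ R (Fin.tail (Fin.tail (Fin.tail x))) (Fin.tail x 0) (x 0) := by
  have := Closed.subst h (F := fun x : Fin (n + 2 + 1) → M =>
    Fin.cons (x 0) (Fin.cons (x 1) (Fin.tail (Fin.tail (Fin.tail x))))) (fun i => by
      refine Fin.cases ?_ (Fin.cases ?_ fun i => ?_) i
      · exact PolyFun.coord 0
      · exact PolyFun.coord 1
      · exact PolyFun.coord i.succ.succ.succ)
  simp only [Fin.cons_zero, Fin.tail_cons] at this
  exact this

lemma isSigma_skip {R : (Fin n → M) → M → Prop}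
    (h : IsSigma k fun x : Fin (n + 1) → M => ¬ R (Fin.tail x) (x 0)) :
    IsSigma k fun x : Fin (n + 1 + 1) → M => ¬ R (Fin.tail (Fin.tail x)) (x 0) := by
  have := Closed.subst h (F := fun x : Fin (n + 1 + 1) → M =>
    Fin.cons (x 0) (Fin.tail (Fin.tail x))) (fun i => by
      refine Fin.cases ?_ (fun i => ?_) i
      · exact PolyFun.coord 0
      · exact PolyFun.coord i.succ.succ)
  simpa using this

end Succ

variable [PAMinus M]

lemma lt_add_one' (a : M) : a < a + 1 := lt_add_of_pos_right a zero_lt_one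

lemma lt_succ_iff {a b : M} : a < b + 1 ↔ a ≤ b := by
  refine ⟨fun h => ?_, fun h => h.trans_lt (lt_add_one' b)⟩
  by_contra! hb
  obtain ⟨c, rfl⟩ := exists_add_of_le hb.le
  have := PAMinus.one_le_of_pos c (pos_of_lt_add_right hb)
  exact absurd h (not_lt.2 (by gcongr))

lemma succ_le_iff {a b : M} : a + 1 ≤ b ↔ a < b := by
  rw [← not_lt, lt_succ_iff, not_le]

/-- Collection for `Πₖ` matrices, by induction on the part of `[0, t)` already bounded. Only closure
at level `k` may be used, because closure at level `k + 1` is derived from this. -/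
lemma exists_bound {k n : ℕ} [Closed M k] (h : ISigma M (k + 1)) {R : (Fin n → M) → M → M → Prop}
    (hR : IsSigma k fun x : Fin (n + 2) → M => ¬ R (Fin.tail (Fin.tail x)) (Fin.tail x 0) (x 0))
    (x : Fin n → M) (t : M) (ht : ∀ y < t, ∃ z, R x y z) : ∃ w, ∀ y < t, ∃ z < w, R x y z := by
  have key : ∀ s, s ∈ {s : M | s ≤ t → ∃ w, ∀ y < s, ∃ z < w, R x y z} := by
    apply h
    · refine isSigma_succ_iff.2 ⟨fun v w => t < v 0 ∨ ∀ y < v 0, ∃ z < w, R x y z, ?_, ?_⟩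
      · simp only [not_or]
        refine Closed.and ((IsDelta0.lt_of_poly (.const t) (.coord 1)).not.isSigma k) ?_
        refine isSigma_not_ball (.coord 1) (isSigma_not_bex (R := fun v z => R x (v 0) z)
          (.coord 1) ?_)
        have := Closed.subst hR (F := fun v : Fin 4 → M =>
          Fin.cons (v 0) (Fin.cons (v 1) x)) (fun i => by
            refine Fin.cases ?_ (Fin.cases ?_ fun i => ?_) i
            · exact PolyFun.coord 0
            · exact PolyFun.coord 1
            · exact PolyFun.const _)
        simp only [Fin.cons_zero, Fin.tail_cons] at this
        exact this
      · ext v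
        change (_ → _) ↔ _
        by_cases hv : v 0 ≤ t
        · simp [hv, not_lt.2 hv]
        · simp [hv, not_le.1 hv]
    · exact fun _ => ⟨0, fun y hy => absurd hy not_lt_zero⟩
    · intro s ih hs
      obtain ⟨w, hw⟩ := ih ((lt_add_one' s).le.trans hs)
      obtain ⟨z, hz⟩ := ht s (succ_le_iff.1 hs)
      refine ⟨max w (z + 1), fun y hy => ?_⟩
      rcases (lt_succ_iff.1 hy).lt_or_eq with hy | rfl
      · obtain ⟨z, hz, hR⟩ := hw y hy
        exact ⟨z, lt_max_of_lt_left hz, hR⟩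
      · exact ⟨z, lt_max_of_lt_right (lt_add_one' z), hz⟩
  exact key t le_rfl

/-- Several unbounded witnesses are merged into a single bound `w`, below which they are sought by
bounded quantifiers; this keeps the matrix `Πₖ`. Only the bounded universal quantifier needs
collection. -/
lemma Closed.succ {k : ℕ} [hc : Closed M k] (h : ISigma M (k + 1)) : Closed M (k + 1) where
  subst {m n R} hR F hF := by
    obtain ⟨S, hS, rfl⟩ := isSigma_succ_iff.1 hR
    refine isSigma_succ_iff.2 ⟨fun x y => S (F x) y, ?_, rfl⟩
    simpa using Closed.subst hS (PolyFun.cons hF)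
  and {n R S} hR hS := by
    obtain ⟨R, hR', rfl⟩ := isSigma_succ_iff.1 hR
    obtain ⟨S, hS', rfl⟩ := isSigma_succ_iff.1 hS
    refine isSigma_succ_iff.2 ⟨fun x w => (∃ y < w + 1, R x y) ∧ ∃ y < w + 1, S x y, ?_, ?_⟩
    · simp only [not_and_or]
      exact hc.or (isSigma_not_bex (.add (.coord 0) (.const 1)) (isSigma_skip hR'))
        (isSigma_not_bex (.add (.coord 0) (.const 1)) (isSigma_skip hS'))
    · ext x
      constructor
      · rintro ⟨⟨y, hy⟩, z, hz⟩
        exact ⟨max y z, ⟨y, lt_succ_iff.2 (le_max_left _ _), hy⟩, z,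
          lt_succ_iff.2 (le_max_right _ _), hz⟩
      · rintro ⟨w, ⟨y, -, hy⟩, z, -, hz⟩
        exact ⟨⟨y, hy⟩, z, hz⟩
  or {n R S} hR hS := by
    obtain ⟨R, hR', rfl⟩ := isSigma_succ_iff.1 hR
    obtain ⟨S, hS', rfl⟩ := isSigma_succ_iff.1 hS
    refine isSigma_succ_iff.2 ⟨fun x y => R x y ∨ S x y, ?_, ?_⟩
    · simp only [not_or]
      exact hc.and hR' hS'
    · ext x; exact exists_or.symm
  ball_poly {n t} ht R hR := by
    obtain ⟨S, hS, h'⟩ := isSigma_succ_iff.1 hR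
    have hRS : ∀ x y, R x y ↔ ∃ z, S (Fin.cons y x) z := fun x y => by
      simpa using congrFun h' (Fin.cons y x)
    have hS' : IsSigma k fun x : Fin (n + 2) → M =>
        ¬ S (Fin.cons (Fin.tail x 0) (Fin.tail (Fin.tail x))) (x 0) := by simpa using hS
    refine isSigma_succ_iff.2 ⟨fun x w => ∀ y < t x, ∃ z < w, S (Fin.cons y x) z, ?_, ?_⟩
    · refine isSigma_not_ball (ht.comp fun i => .coord i.succ) ?_
      refine isSigma_not_bex
        (R := fun v z => S (Fin.cons (v 0) (Fin.tail (Fin.tail v))) z) (.coord 1) ?_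
      exact isSigma_permute (R := fun x y z => S (Fin.cons y x) z) hS'
    · ext x
      simp only [hRS]
      refine ⟨exists_bound h (R := fun x y z => S (Fin.cons y x) z) hS' x (t x), ?_⟩
      rintro ⟨w, hw⟩ y hy
      obtain ⟨z, -, hz⟩ := hw y hy
      exact ⟨z, hz⟩
  bex_poly {n t} ht R hR := by
    obtain ⟨S, hS, h'⟩ := isSigma_succ_iff.1 hR
    have hRS : ∀ x y, R x y ↔ ∃ z, S (Fin.cons y x) z := fun x y => by
      simpa using congrFun h' (Fin.cons y x)
    have hS' : IsSigma k fun x : Fin (n + 2) → M =>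
        ¬ S (Fin.cons (Fin.tail x 0) (Fin.tail (Fin.tail x))) (x 0) := by simpa using hS
    refine isSigma_succ_iff.2 ⟨fun x w => ∃ y < t x, ∃ z < w, S (Fin.cons y x) z, ?_, ?_⟩
    · refine isSigma_not_bex (ht.comp fun i => .coord i.succ) ?_
      refine isSigma_not_bex
        (R := fun v z => S (Fin.cons (v 0) (Fin.tail (Fin.tail v))) z) (.coord 1) ?_
      exact isSigma_permute (R := fun x y z => S (Fin.cons y x) z) hS'
    · ext x
      simp only [hRS]
      constructor
      · rintro ⟨y, hy, z, hz⟩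
        exact ⟨z + 1, y, hy, z, lt_add_one' z, hz⟩
      · rintro ⟨w, y, hy, z, -, hz⟩
        exact ⟨y, hy, z, hz⟩
  ex _ n R hR := by
    obtain ⟨S, hS, h'⟩ := isSigma_succ_iff.1 hR
    have hRS : ∀ x y, R x y ↔ ∃ z, S (Fin.cons y x) z := fun x y => by
      simpa using congrFun h' (Fin.cons y x)
    have hS' : IsSigma k fun x : Fin (n + 2) → M =>
        ¬ S (Fin.cons (Fin.tail x 0) (Fin.tail (Fin.tail x))) (x 0) := by simpa using hS
    refine isSigma_succ_iff.2 ⟨fun x w => ∃ y < w, ∃ z < w, S (Fin.cons y x) z, ?_, ?_⟩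
    · refine isSigma_not_bex (.coord 0) ?_
      refine isSigma_not_bex
        (R := fun v z => S (Fin.cons (v 0) (Fin.tail (Fin.tail v))) z) (.coord 1) ?_
      exact isSigma_permute (R := fun x y z => S (Fin.cons y x) z) hS'
    · ext x
      simp only [hRS]
      constructor
      · rintro ⟨y, z, hz⟩
        exact ⟨max y z + 1, y, lt_succ_iff.2 (le_max_left _ _), z,
          lt_succ_iff.2 (le_max_right _ _), hz⟩
      · rintro ⟨w, y, -, z, -, hz⟩
        exact ⟨y, z, hz⟩

end Definability

end Arith

namespace Arith

/-! ### Definable functions, `Δₖ` relations, and the induction, least number and collection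
principles. -/

section Levels

variable {M : Type u} [CommSemiring M] [LinearOrder M]

variable (M) in
/-- `M` satisfies `IΣₖ`, `k ≥ 1`, and its `Σₖ` relations have the closure properties that follow. -/
class Level (k : ℕ) : Prop extends Closed M k where
  pos : 0 < k
  ind : ISigma M k

lemma level_one [PAMinus M] (h : ISigma M 1) : Level M 1 where
  toClosed := haveI := closed_zero (M := M); Closed.succ h
  pos := one_pos
  ind := h

lemma level_two [PAMinus M] [Level M 1] (h : ISigma M 2) : Level M 2 where
  toClosed := Closed.succ h
  pos := two_pos
  ind := h

/-- `R` is both `Σₖ` and `Πₖ`. -/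
def IsDelta (k : ℕ) {n : ℕ} (R : (Fin n → M) → Prop) : Prop :=
  IsSigma k R ∧ IsSigma k fun x => ¬ R x

/-- The graph of `f` is `Σₖ`. -/
def DefFun (k : ℕ) {n : ℕ} (f : (Fin n → M) → M) : Prop :=
  IsSigma k fun x : Fin (n + 1) → M => x 0 = f (Fin.tail x)

variable {k n m : ℕ}

lemma PolyFun.defFun {f : (Fin n → M) → M} (hf : PolyFun f) : DefFun k f :=
  (IsDelta0.eq_of_poly (.coord 0) (hf.comp (F := Fin.tail) fun i => .coord i.succ)).isSigma k

variable [Level M k]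

lemma DefFun.subst {f : (Fin n → M) → M} (hf : DefFun k f) {F : (Fin m → M) → Fin n → M}
    (hF : ∀ i, PolyFun fun x => F x i) : DefFun k fun x => f (F x) := by
  have := Closed.subst hf (PolyFun.cons hF)
  simp only [Fin.cons_zero, Fin.tail_cons] at this
  exact this

lemma DefFun.tail {f : (Fin n → M) → M} (hf : DefFun k f) :
    DefFun k fun x : Fin (n + 1) → M => f (Fin.tail x) :=
  hf.subst fun i => .coord i.succ

omit [Level M k] in
lemma DefFun.coord (i : Fin n) : DefFun k fun x : Fin n → M => x i :=
  (PolyFun.coord i).defFun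

omit [Level M k] in
lemma DefFun.const (a : M) : DefFun k fun _ : Fin n → M => a :=
  (PolyFun.const a).defFun

namespace IsSigma

lemma and {R S : (Fin n → M) → Prop} (hR : IsSigma k R) (hS : IsSigma k S) :
    IsSigma k fun x => R x ∧ S x := Closed.and hR hS

lemma or {R S : (Fin n → M) → Prop} (hR : IsSigma k R) (hS : IsSigma k S) :
    IsSigma k fun x => R x ∨ S x := Closed.or hR hS

lemma ex {R : (Fin n → M) → M → Prop}
    (hR : IsSigma k fun x : Fin (n + 1) → M => R (Fin.tail x) (x 0)) :
    IsSigma k fun x => ∃ y, R x y := Closed.ex (Level.pos M) hR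

/-- A total function with `Σₖ` graph can be substituted at the cost of one existential quantifier.
Applied to a relation and to its negation, this also preserves `Δₖ`. -/
lemma letFun {R : (Fin n → M) → M → Prop} {f : (Fin n → M) → M} (hf : DefFun k f)
    (hR : IsSigma k fun x : Fin (n + 1) → M => R (Fin.tail x) (x 0)) :
    IsSigma k fun x => R x (f x) := by
  have : IsSigma k fun x => ∃ y, y = f x ∧ R x y := .ex (.and hf hR)
  simpa using this

lemma comp {R : (Fin m → M) → Prop} (hR : IsSigma k R) {F : (Fin n → M) → Fin m → M}
    (hF : ∀ i, DefFun k fun x => F x i) : IsSigma k fun x => R (F x) := by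
  -- The first `j` coordinates are definable functions and the others polynomials; each step turns
  -- one definable coordinate into a fresh variable.
  have key : ∀ j ≤ m, ∀ (n : ℕ) (F : (Fin n → M) → Fin m → M),
      (∀ i : Fin m, i.val < j → DefFun k fun x => F x i) →
      (∀ i : Fin m, j ≤ i.val → PolyFun fun x => F x i) → IsSigma k fun x => R (F x) := by
    intro j
    induction j with
    | zero => exact fun _ n F _ hF => Closed.subst hR fun i => hF i (Nat.zero_le _)
    | succ j ih =>
      intro hj n F hF hF'
      have h := letFun (R := fun x y => R (Function.update (F x) ⟨j, hj⟩ y)) (hF ⟨j, hj⟩ (by simp))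
        (ih (by omega) (n + 1) (fun x => Function.update (F (Fin.tail x)) ⟨j, hj⟩ (x 0)) ?_ ?_)
      · simpa using h
      · intro i hi
        have : i ≠ ⟨j, hj⟩ := fun h => by simp [h] at hi
        simpa [Function.update_of_ne this] using (hF i (by omega)).tail
      · intro i hi
        by_cases h : i = ⟨j, hj⟩
        · subst h; simpa using PolyFun.coord 0
        · have : j < i.val := lt_of_le_of_ne hi fun h' => h (Fin.ext h'.symm)
          simpa [Function.update_of_ne h] using
            (hF' i this).comp (F := Fin.tail) fun i => PolyFun.coord i.succ
  exact key m le_rfl n F (fun i _ => hF i) fun i hi => absurd i.isLt (not_lt.2 hi)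

lemma comp₁ {P : M → Prop} (hP : IsSigma k fun x : Fin 1 → M => P (x 0)) {f : (Fin n → M) → M}
    (hf : DefFun k f) : IsSigma k fun x => P (f x) :=
  hP.comp (F := fun x _ => f x) fun _ => hf

lemma comp₂ {P : M → M → Prop} (hP : IsSigma k fun x : Fin 2 → M => P (x 0) (x 1))
    {f g : (Fin n → M) → M} (hf : DefFun k f) (hg : DefFun k g) :
    IsSigma k fun x => P (f x) (g x) := by
  simpa using hP.comp (F := fun x => ![f x, g x]) fun i => by fin_cases i <;> simpa

end IsSigma

lemma DefFun.comp {f : (Fin m → M) → M} (hf : DefFun k f) {F : (Fin n → M) → Fin m → M}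
    (hF : ∀ i, DefFun k fun x => F x i) : DefFun k fun x => f (F x) := by
  have := IsSigma.comp (R := fun x : Fin (m + 1) → M => x 0 = f (Fin.tail x)) hf
    (F := fun x : Fin (n + 1) → M => Fin.cons (x 0) (F (Fin.tail x))) fun i => by
      refine Fin.cases ?_ (fun i => ?_) i
      · exact .coord 0
      · exact (hF i).tail
  simp only [Fin.cons_zero, Fin.tail_cons] at this
  exact this

lemma DefFun.comp₁ {f : M → M} (hf : DefFun k fun x : Fin 1 → M => f (x 0)) {g : (Fin n → M) → M}
    (hg : DefFun k g) : DefFun k fun x => f (g x) :=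
  hf.comp (F := fun x _ => g x) fun _ => hg

lemma DefFun.comp₂ {f : M → M → M} (hf : DefFun k fun x : Fin 2 → M => f (x 0) (x 1))
    {g h : (Fin n → M) → M} (hg : DefFun k g) (hh : DefFun k h) :
    DefFun k fun x => f (g x) (h x) := by
  simpa using hf.comp (F := fun x => ![g x, h x]) fun i => by fin_cases i <;> simpa

lemma DefFun.add {f g : (Fin n → M) → M} (hf : DefFun k f) (hg : DefFun k g) :
    DefFun k fun x => f x + g x :=
  .comp₂ (f := fun a b => a + b) (PolyFun.add (.coord 0) (.coord 1)).defFun hf hg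

lemma DefFun.mul {f g : (Fin n → M) → M} (hf : DefFun k f) (hg : DefFun k g) :
    DefFun k fun x => f x * g x :=
  .comp₂ (f := fun a b => a * b) (PolyFun.mul (.coord 0) (.coord 1)).defFun hf hg

namespace IsDelta

variable {R S : (Fin n → M) → Prop} {f g : (Fin n → M) → M}

lemma comp₁ {P : M → Prop} (hP : IsDelta k fun x : Fin 1 → M => P (x 0))
    (hf : DefFun k f) : IsDelta k fun x => P (f x) :=
  ⟨hP.1.comp₁ hf, IsSigma.comp₁ (P := fun x => ¬ P x) hP.2 hf⟩

lemma comp₂ {P : M → M → Prop} (hP : IsDelta k fun x : Fin 2 → M => P (x 0) (x 1))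
    (hf : DefFun k f) (hg : DefFun k g) : IsDelta k fun x => P (f x) (g x) :=
  ⟨hP.1.comp₂ hf hg, IsSigma.comp₂ (P := fun x y => ¬ P x y) hP.2 hf hg⟩

omit [Level M k] in
lemma _root_.Arith.IsDelta0.isDelta (h : IsDelta0 R) : IsDelta k R :=
  ⟨h.isSigma k, h.not.isSigma k⟩

omit [Level M k] in
lemma not (h : IsDelta k R) : IsDelta k fun x => ¬ R x :=
  ⟨h.2, by simpa only [not_not] using h.1⟩

lemma and (hR : IsDelta k R) (hS : IsDelta k S) : IsDelta k fun x => R x ∧ S x :=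
  ⟨hR.1.and hS.1, by simpa only [not_and_or] using hR.2.or hS.2⟩

lemma or (hR : IsDelta k R) (hS : IsDelta k S) : IsDelta k fun x => R x ∨ S x :=
  ⟨hR.1.or hS.1, by simpa only [not_or] using hR.2.and hS.2⟩

lemma imp (hR : IsDelta k R) (hS : IsDelta k S) : IsDelta k fun x => R x → S x := by
  simpa only [← imp_iff_not_or] using hR.not.or hS

lemma eq (hf : DefFun k f) (hg : DefFun k g) : IsDelta k fun x => f x = g x :=
  .comp₂ (P := fun a b => a = b) (IsDelta0.eq_of_poly (.coord 0) (.coord 1)).isDelta hf hg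

lemma lt (hf : DefFun k f) (hg : DefFun k g) : IsDelta k fun x => f x < g x :=
  .comp₂ (P := fun a b => a < b) (IsDelta0.lt_of_poly (.coord 0) (.coord 1)).isDelta hf hg

lemma le (hf : DefFun k f) (hg : DefFun k g) : IsDelta k fun x => f x ≤ g x := by
  simpa only [not_lt] using (IsDelta.lt hg hf).not

end IsDelta

lemma isSigma_insert {R : (Fin n → M) → M → Prop}
    (hR : IsSigma k fun x : Fin (n + 1) → M => R (Fin.tail x) (x 0)) :
    IsSigma k fun x : Fin (n + 1 + 1) → M => R (Fin.tail (Fin.tail x)) (x 0) := by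
  have := Closed.subst hR (F := fun x : Fin (n + 1 + 1) → M =>
    Fin.cons (x 0) (Fin.tail (Fin.tail x))) (fun i => by
      refine Fin.cases ?_ (fun i => ?_) i
      · exact PolyFun.coord 0
      · exact PolyFun.coord i.succ.succ)
  simpa using this

lemma IsSigma.ball {R : (Fin n → M) → M → Prop} {t : (Fin n → M) → M} (ht : DefFun k t)
    (hR : IsSigma k fun x : Fin (n + 1) → M => R (Fin.tail x) (x 0)) :
    IsSigma k fun x => ∀ y < t x, R x y :=
  letFun (R := fun x w => ∀ y < w, R x y) ht
    (Closed.ball_poly (R := fun x y => R (Fin.tail x) y) (.coord 0) (isSigma_insert hR))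

lemma IsSigma.bex {R : (Fin n → M) → M → Prop} {t : (Fin n → M) → M} (ht : DefFun k t)
    (hR : IsSigma k fun x : Fin (n + 1) → M => R (Fin.tail x) (x 0)) :
    IsSigma k fun x => ∃ y < t x, R x y :=
  letFun (R := fun x w => ∃ y < w, R x y) ht
    (Closed.bex_poly (R := fun x y => R (Fin.tail x) y) (.coord 0) (isSigma_insert hR))

lemma IsDelta.ball {R : (Fin n → M) → M → Prop} {t : (Fin n → M) → M} (ht : DefFun k t)
    (hR : IsDelta k fun x : Fin (n + 1) → M => R (Fin.tail x) (x 0)) :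
    IsDelta k fun x => ∀ y < t x, R x y := by
  refine ⟨.ball ht hR.1, ?_⟩
  simpa using IsSigma.bex (R := fun x y => ¬ R x y) ht hR.2

lemma IsDelta.bex {R : (Fin n → M) → M → Prop} {t : (Fin n → M) → M} (ht : DefFun k t)
    (hR : IsDelta k fun x : Fin (n + 1) → M => R (Fin.tail x) (x 0)) :
    IsDelta k fun x => ∃ y < t x, R x y := by
  refine ⟨.bex ht hR.1, ?_⟩
  simpa using IsSigma.ball (R := fun x y => ¬ R x y) ht hR.2

lemma DefFun.ite {R : (Fin n → M) → Prop} [∀ x, Decidable (R x)] {f g : (Fin n → M) → M} (hR : IsDelta k R)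
    (hf : DefFun k f) (hg : DefFun k g) : DefFun k fun x => if R x then f x else g x := by
  have h₁ : IsSigma k fun x : Fin (n + 1) → M => R (Fin.tail x) :=
    Closed.subst hR.1 fun i => .coord i.succ
  have h₂ : IsSigma k fun x : Fin (n + 1) → M => ¬ R (Fin.tail x) :=
    Closed.subst hR.2 fun i => .coord i.succ
  have : IsSigma k fun x : Fin (n + 1) → M =>
      R (Fin.tail x) ∧ x 0 = f (Fin.tail x) ∨ ¬ R (Fin.tail x) ∧ x 0 = g (Fin.tail x) :=
    (h₁.and hf).or (h₂.and hg)
  refine (congrArg (IsSigma k) (funext fun x => ?_)).mp this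
  by_cases h : R (Fin.tail x) <;> simp [h]

section Induction

lemma sigma_induction {P : M → Prop} (hP : IsSigma k fun x : Fin 1 → M => P (x 0)) (h0 : P 0)
    (hs : ∀ x, P x → P (x + 1)) : ∀ x, P x :=
  Level.ind (k := k) {x | P x} hP h0 hs

variable [PAMinus M]

lemma pi_induction {P : M → Prop} (hP : IsSigma k fun x : Fin 1 → M => ¬ P (x 0)) (h0 : P 0)
    (hs : ∀ x, P x → P (x + 1)) : ∀ x, P x := by
  by_contra! ⟨x, hx⟩
  -- `Σₖ` induction run downwards from the counterexample: `P` fails at `x - y` for all `y ≤ x`,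
  -- hence at `0`.
  have key : ∀ y, x < y ∨ ∃ z < x + 1, y + z = x ∧ ¬ P z := by
    refine sigma_induction (k := k) ?_ ?_ ?_
    · refine .or (IsDelta.lt (.const x) (.coord 0)).1 (.bex (.const _) (.and ?_ ?_))
      · exact (IsDelta.eq (.add (.coord 1) (.coord 0)) (.const x)).1
      · exact hP.comp₁ (P := fun z => ¬ P z) (.coord 0)
    · exact Or.inr ⟨x, lt_add_one' x, zero_add x, hx⟩
    · rintro y (h | ⟨z, -, rfl, hz⟩)
      · exact Or.inl (h.trans (lt_add_one' y))
      · rcases eq_or_ne z 0 with rfl | h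
        · exact absurd h0 hz
        · obtain ⟨w, rfl⟩ := exists_add_of_le (PAMinus.one_le_of_pos z (pos_iff_ne_zero.2 h))
          refine Or.inr ⟨w, ?_, by ring, fun hw => hz (add_comm w 1 ▸ hs w hw)⟩
          rw [lt_succ_iff, show y + (1 + w) = (y + 1) + w by ring]
          exact le_add_self
  rcases key x with h | ⟨z, -, h, hz⟩
  · exact lt_irrefl x h
  · exact hz ((add_eq_left.1 h).symm ▸ h0)

lemma exists_least_of_pi {P : M → Prop} (hP : IsSigma k fun x : Fin 1 → M => ¬ P (x 0))
    (h : ∃ x, P x) : ∃ x, P x ∧ ∀ y < x, ¬ P y := by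
  by_contra! hn
  obtain ⟨x, hx⟩ := h
  have key : ∀ x, ∀ y < x, ¬ P y := by
    refine sigma_induction (k := k) ?_ ?_ ?_
    · exact .ball (.coord 0) (hP.comp₁ (P := fun z => ¬ P z) (.coord 0))
    · exact fun y hy => absurd hy not_lt_zero
    · intro x ih y hy hPy
      obtain ⟨z, hz, hPz⟩ := hn y hPy
      exact ih z (hz.trans_le (lt_succ_iff.1 hy)) hPz
  exact key (x + 1) x (lt_add_one' x) hx

lemma exists_least_of_sigma {P : M → Prop} (hP : IsSigma k fun x : Fin 1 → M => P (x 0))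
    (h : ∃ x, P x) : ∃ x, P x ∧ ∀ y < x, ¬ P y := by
  by_contra! hn
  obtain ⟨x, hx⟩ := h
  have key : ∀ x, ∀ y < x, ¬ P y := by
    refine pi_induction (k := k) ?_ ?_ ?_
    · have := IsSigma.bex (t := fun x : Fin 1 → M => x 0) (R := fun _ y => P y) (.coord 0)
        (hP.comp₁ (P := fun z => P z) (.coord 0))
      simpa using this
    · exact fun y hy => absurd hy not_lt_zero
    · intro x ih y hy hPy
      obtain ⟨z, hz, hPz⟩ := hn y hPy
      exact ih z (hz.trans_le (lt_succ_iff.1 hy)) hPz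
  exact key (x + 1) x (lt_add_one' x) hx

lemma sigma_collection {R : M → M → Prop} (hR : IsSigma k fun x : Fin 2 → M => R (x 0) (x 1))
    (t : M) (h : ∀ y < t, ∃ z, R y z) : ∃ w, ∀ y < t, ∃ z < w, R y z := by
  have key : ∀ s, t < s ∨ ∃ w, ∀ y < s, ∃ z < w, R y z := by
    refine sigma_induction (k := k) ?_ ?_ ?_
    · refine .or (IsDelta.lt (.const t) (.coord 0)).1 (.ex (.ball (.coord 1) (.bex (.coord 1) ?_)))
      exact hR.comp₂ (.coord 1) (.coord 0)
    · exact Or.inr ⟨0, fun y hy => absurd hy not_lt_zero⟩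
    · rintro s (hs | ⟨w, hw⟩)
      · exact Or.inl (hs.trans (lt_add_one' s))
      · rcases lt_or_ge s t with hs | hs
        · obtain ⟨z, hz⟩ := h s hs
          refine Or.inr ⟨max w (z + 1), fun y hy => ?_⟩
          rcases (lt_succ_iff.1 hy).lt_or_eq with hy | rfl
          · obtain ⟨z, hz, hR⟩ := hw y hy
            exact ⟨z, lt_max_of_lt_left hz, hR⟩
          · exact ⟨z, lt_max_of_lt_right (lt_add_one' z), hz⟩
        · exact Or.inl (hs.trans_lt (lt_add_one' s))
  exact (key t).resolve_left (lt_irrefl t)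

end Induction

end Levels

end Arith

namespace Arith

/-! ### Gödel's `β` function and primitive recursion. -/

section Coding

variable {M : Type u} [CommSemiring M] [LinearOrder M] [PAMinus M]

lemma div_unique {m q r q' r' : M} (hr : r < m) (hr' : r' < m) (h : q * m + r = q' * m + r') :
    q = q' ∧ r = r' := by
  have key : ∀ {q r q' r' : M}, r < m → q * m + r = q' * m + r' → q' ≤ q := by
    intro q r q' r' hr h
    by_contra! hq
    have : (q + 1) * m ≤ q' * m := by have := succ_le_iff.2 hq; gcongr
    simp only [Diff.of_le, Diff.of_lt, Diff.of_inj, map_add, map_mul, map_one] at *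
    nlinarith [Diff.of_nonneg r']
  obtain rfl := le_antisymm (key hr' h.symm) (key hr h)
  exact ⟨rfl, add_left_cancel h⟩

lemma Beta.unique {a b i v w : M} (hv : Beta a b i v) (hw : Beta a b i w) : v = w := by
  obtain ⟨hv, q, rfl⟩ := hv
  obtain ⟨hw, q', h⟩ := hw
  exact (div_unique hv hw h).2

/-- The entry at place `i` of the sequence that is coded by `(a, b)`. -/
noncomputable def entry (a b i : M) : M := Classical.epsilon fun v => Beta a b i v

variable [Level M 1]

lemma exists_div (x : M) {m : M} (hm : 0 < m) : ∃ q r, r < m ∧ x = q * m + r := by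
  revert x
  refine sigma_induction (k := 1) ?_ ⟨0, 0, hm, by simp⟩ ?_
  · refine .ex (.ex (.and (IsDelta.lt (.coord 0) (.const m)).1 (IsDelta.eq (.coord 2) ?_).1))
    exact .add (.mul (.coord 1) (.const m)) (.coord 0)
  · rintro x ⟨q, r, hr, rfl⟩
    rcases (succ_le_iff.2 hr).lt_or_eq with h | rfl
    · exact ⟨q, r + 1, h, by ring⟩
    · exact ⟨q + 1, 0, hm, by ring⟩

lemma beta_iff {a b i v : M} : Beta a b i v ↔ v = entry a b i := by
  have h : Beta a b i (entry a b i) := by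
    apply Classical.epsilon_spec (p := fun v => Beta a b i v)
    obtain ⟨q, r, hr, h⟩ := exists_div a (m := 1 + (i + 1) * b)
      (zero_lt_one.trans_le le_self_add)
    exact ⟨r, hr, q, h⟩
  exact ⟨fun h' => h'.unique h, fun h' => h' ▸ h⟩

variable {k n : ℕ} [Level M k]

omit [PAMinus M] [Level M 1] in
lemma DefFun.mono {k l : ℕ} (hkl : k ≤ l) {f : (Fin n → M) → M} (h : DefFun k f) : DefFun l f := by
  induction hkl with
  | refl => exact h
  | step _ ih => exact IsSigma.succ ih

lemma DefFun.entry {a b i : (Fin n → M) → M} (ha : DefFun k a) (hb : DefFun k b)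
    (hi : DefFun k i) : DefFun k fun x => entry (a x) (b x) (i x) := by
  have : DefFun k fun x : Fin 3 → M => Arith.entry (x 0) (x 1) (x 2) := by
    have h : IsSigma k fun x : Fin (3 + 1) → M => Beta (x 1) (x 2) (x 3) (x 0) := by
      refine .and (IsDelta.lt (.coord 0) (.add (.const 1) (.mul (.add (.coord 3) (.const 1))
        (.coord 2)))).1 (.ex (IsDelta.eq (.coord 2) (.add (.mul (.coord 0) (.add (.const 1)
          (.mul (.add (.coord 4) (.const 1)) (.coord 3)))) (.coord 1))).1)
    simp only [beta_iff] at h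
    exact h
  simpa using this.comp (F := fun x => ![a x, b x, i x]) fun i => by fin_cases i <;> simpa

/-- Stands in for `n!`: such a `b` makes the moduli `1 + (i + 1) b`, `i < n`, pairwise coprime. -/
lemma exists_common_multiple (n : M) : ∃ b : M, 0 < b ∧ ∀ j < n, ∃ c, b = (j + 1) * c := by
  revert n
  refine sigma_induction (k := 1) ?_ ⟨1, one_pos, fun j hj => absurd hj not_lt_zero⟩ ?_
  · refine .ex (.and (IsDelta.lt (.const 0) (.coord 0)).1 (.ball (.coord 1) (.ex ?_)))
    exact (IsDelta.eq (.coord 2) (.mul (.add (.coord 1) (.const 1)) (.coord 0))).1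
  · rintro n ⟨b, hb, h⟩
    refine ⟨b * (n + 1), mul_pos hb (zero_lt_one.trans_le le_add_self), fun j hj => ?_⟩
    rcases (lt_succ_iff.1 hj).lt_or_eq with hj | rfl
    · obtain ⟨c, hc⟩ := h j hj
      exact ⟨c * (n + 1), by rw [hc]; ring⟩
    · exact ⟨b, mul_comm _ _⟩

-- With `K = i + d + 1`, modulo `1 + K b` one has `K b ≡ -1` and `1 + (i + 1) b ≡ -d b`. As `b = d
-- c`, the inverse of the latter is `-c K²`; multiplying by `K b` instead of `-1` gives the
-- nonnegative witness `b c K³`.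
omit [Level M 1] in
lemma modulus_inverse {b c i d : M} (hb : 0 < b) (hc : b = d * c) :
    ∃ t s, (1 + (i + 1) * b) * t = 1 + (1 + (i + d + 1) * b) * s := by
  have h1 : 1 ≤ (i + d + 1) * b := PAMinus.one_le_of_pos _
    (mul_pos (zero_lt_one.trans_le le_add_self) hb)
  obtain ⟨e, he⟩ := exists_add_of_le h1
  refine ⟨b * c * (i + d + 1) ^ 3, b * (i + d + 1) ^ 2 * c * (i + 1) + e, ?_⟩
  simp only [Diff.of_inj, map_add, map_mul, map_one, map_pow] at *
  generalize Diff.of b = b at *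
  generalize Diff.of c = c at *
  generalize Diff.of i = i at *
  generalize Diff.of d = d at *
  generalize Diff.of e = e at *
  obtain rfl : e = (i + d + 1) * b - 1 := by rw [he]; ring
  subst hc
  ring

/-- Every definable sequence has a code. -/
lemma exists_code {F : M → M} (hF : DefFun k fun x : Fin 1 → M => F (x 0)) (n : M) :
    ∃ a b, ∀ i < n, entry a b i = F i := by
  obtain ⟨B, hB⟩ : ∃ B, ∀ i < n, ∃ z < B, z = F i :=
    sigma_collection (k := k) (R := fun i z => z = F i)
      (IsDelta.eq (.coord 1) (hF.comp₁ (.coord 0))).1 n fun i _ => ⟨_, rfl⟩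
  obtain ⟨b₀, hb₀, hdvd₀⟩ := exists_common_multiple n
  obtain ⟨b, hb, hBb, hdvd⟩ : ∃ b, 0 < b ∧ B ≤ b ∧ ∀ j < n, ∃ c, b = (j + 1) * c := by
    refine ⟨b₀ * (B + 1), mul_pos hb₀ (zero_lt_one.trans_le le_add_self), ?_, fun j hj => ?_⟩
    · calc B ≤ 1 * (B + 1) := by rw [one_mul]; exact le_self_add
        _ ≤ b₀ * (B + 1) := by have := PAMinus.one_le_of_pos _ hb₀; gcongr
    · obtain ⟨c, hc⟩ := hdvd₀ j hj
      exact ⟨c * (B + 1), by rw [hc]; ring⟩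
  -- Chinese remaindering one modulus at a time: `P` is a common multiple of the moduli already
  -- treated and is invertible modulo each remaining one.
  have key : ∀ l, n < l ∨ ∃ a P, (∀ i < l, entry a b i = F i) ∧
      (∀ i < l, ∃ c, P = (1 + (i + 1) * b) * c) ∧
      ∀ j < n, l ≤ j → ∃ t s, P * t = 1 + (1 + (j + 1) * b) * s := by
    refine sigma_induction (k := k) ?_ ?_ ?_
    · refine .or (IsDelta.lt (.const _) (.coord 0)).1 (.ex (.ex (.and ?_ (.and ?_ ?_))))
      · exact .ball (.coord 2) (IsDelta.eq (.entry (.coord 2) (.const b) (.coord 0))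
          (hF.comp₁ (.coord 0))).1
      · exact .ball (.coord 2) (.ex (IsDelta.eq (.coord 2) (.mul (.add (.const 1)
          (.mul (.add (.coord 1) (.const 1)) (.const b))) (.coord 0))).1)
      · have : IsSigma k fun x : Fin 3 → M => ∀ j < n, j < x 2 ∨
            ∃ t s, x 0 * t = 1 + (1 + (j + 1) * b) * s := by
          refine .ball (.const n) (.or (IsDelta.lt (.coord 0) (.coord 3)).1 (.ex (.ex ?_)))
          exact (IsDelta.eq (.mul (.coord 3) (.coord 1)) (.add (.const 1) (.mul (.add (.const 1)
            (.mul (.add (.coord 2) (.const 1)) (.const b))) (.coord 0)))).1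
        simp only [or_iff_not_imp_left, not_lt] at this
        exact this
    · refine Or.inr ⟨0, 1, fun i hi => absurd hi not_lt_zero, fun i hi => absurd hi not_lt_zero,
        fun j _ _ => ⟨1, 0, by simp⟩⟩
    · rintro l (h | ⟨a, P, ha, hP, hinv⟩)
      · exact Or.inl (h.trans (lt_add_one' l))
      rcases le_or_gt n l with hl | hl
      · exact Or.inl (hl.trans_lt (lt_add_one' l))
      obtain ⟨t, s, hts⟩ := hinv l hl le_rfl
      -- Multiples of `P` leave the earlier entries alone. Modulo `1 + (l + 1) b`, `P t ≡ 1` and `(l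
      -- + 1) b a ≡ -a`, so the new code is congruent to `F l` without any subtraction.
      refine Or.inr ⟨a + P * (t * (F l + (l + 1) * b * a)), P * (1 + (l + 1) * b), ?_, ?_, ?_⟩
      · intro i hi
        rcases (lt_succ_iff.1 hi).lt_or_eq with hi | rfl
        · rw [← ha i hi]
          obtain ⟨c, rfl⟩ := hP i hi
          obtain ⟨h₁, q, h₂⟩ := beta_iff.2 (rfl : entry a b i = _)
          refine (beta_iff.1 ⟨h₁, q + c * (t * (F l + (l + 1) * b * a)), ?_⟩).symm
          rw [add_mul q, add_right_comm, ← h₂]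
          ring
        · refine (beta_iff.1 ⟨?_, a + s * (F i + (i + 1) * b * a), ?_⟩).symm
          · obtain ⟨z, hz, rfl⟩ := hB i hl
            calc F i < B := hz
              _ ≤ 1 * b := by rwa [one_mul]
              _ ≤ (i + 1) * b := by gcongr; exact le_add_self
              _ ≤ _ := le_add_self
          · rw [← mul_assoc, hts]; ring
      · intro i hi
        rcases (lt_succ_iff.1 hi).lt_or_eq with hi | rfl
        · obtain ⟨c, rfl⟩ := hP i hi
          exact ⟨c * (1 + (l + 1) * b), by ring⟩
        · exact ⟨P, mul_comm _ _⟩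
      · intro j hj hlj
        obtain ⟨d, rfl⟩ := exists_add_of_le hlj
        obtain ⟨t₁, s₁, h₁⟩ := hinv (l + 1 + d) hj ((lt_add_one' l).le.trans le_self_add)
        obtain ⟨c, hc⟩ := hdvd d ((le_add_self).trans_lt hj)
        obtain ⟨t₂, s₂, h₂⟩ := modulus_inverse (i := l) hb (hc.trans (by rw [add_comm d 1]))
        refine ⟨t₁ * t₂, s₁ + s₂ + (1 + (l + 1 + d + 1) * b) * s₁ * s₂, ?_⟩
        calc _ = (P * t₁) * ((1 + (l + 1) * b) * t₂) := by ring
          _ = _ := by rw [h₁, h₂]; ring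
  obtain ⟨a, P, ha, -⟩ := (key n).resolve_left (lt_irrefl n)
  exact ⟨a, b, ha⟩

/-- Definition by primitive recursion. -/
lemma exists_recursion {G : M → M → M} (hG : DefFun k fun x : Fin 2 → M => G (x 0) (x 1)) (c : M) :
    ∃ F : M → M, DefFun k (fun x : Fin 1 → M => F (x 0)) ∧ F 0 = c ∧
      ∀ i, F (i + 1) = G i (F i) := by
  classical
  let Q : M → M → M → Prop := fun n a b => entry a b 0 = c ∧
    ∀ i < n, entry a b (i + 1) = G i (entry a b i)
  have hQ : IsSigma k fun x : Fin 3 → M => Q (x 0) (x 1) (x 2) := by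
    refine .and (IsDelta.eq (.entry (.coord 1) (.coord 2) (.const 0)) (.const c)).1
      (.ball (.coord 0) (IsDelta.eq (.entry (.coord 2) (.coord 3) (.add (.coord 0) (.const 1)))
        (hG.comp₂ (.coord 0) (.entry (.coord 2) (.coord 3) (.coord 0)))).1)
  have hQ' : ∀ {n} {f g h : (Fin n → M) → M}, DefFun k f → DefFun k g → DefFun k h →
      IsSigma k fun x => Q (f x) (g x) (h x) := by
    intro n f g h hf hg hh
    simpa using hQ.comp (F := fun x => ![f x, g x, h x]) fun i => by fin_cases i <;> simpa
  have hex : ∀ n, ∃ a b, Q n a b := by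
    refine sigma_induction (k := k) (.ex (.ex (hQ' (.coord 2) (.coord 1) (.coord 0)))) ?_ ?_
    · obtain ⟨a, b, h⟩ := exists_code (k := k) (F := fun _ => c) (.const c) 1
      exact ⟨a, b, h 0 zero_lt_one, fun i hi => absurd hi not_lt_zero⟩
    · rintro n ⟨a, b, h0, hs⟩
      obtain ⟨a', b', h⟩ := exists_code (k := k)
        (F := fun i => if i ≤ n then entry a b i else G n (entry a b n))
        (.ite (.le (.coord 0) (.const n)) (.entry (.const a) (.const b) (.coord 0)) (.const _))
        (n + 1 + 1)
      refine ⟨a', b', ?_, fun i hi => ?_⟩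
      · rw [h 0 (zero_lt_one.trans_le le_add_self), if_pos zero_le, h0]
      · have hi' := lt_succ_iff.1 hi
        rw [h i (hi.trans (lt_add_one' _)), if_pos hi', h (i + 1) (by gcongr)]
        rcases hi'.lt_or_eq with h' | rfl
        · rw [if_pos (succ_le_iff.2 h'), hs i h']
        · rw [if_neg (not_le.2 (lt_add_one' i))]
  have huniq : ∀ {n n' a b a' b'}, Q n a b → Q n' a' b' → ∀ i, i ≤ n → i ≤ n' →
      entry a b i = entry a' b' i := by
    intro n n' a b a' b' h h'
    refine sigma_induction (k := k) ?_ ?_ ?_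
    · refine (IsDelta.imp (.le (.coord 0) (.const n)) (.imp (.le (.coord 0) (.const n')) ?_)).1
      exact .eq (.entry (.const a) (.const b) (.coord 0)) (.entry (.const a') (.const b') (.coord 0))
    · exact fun _ _ => h.1.trans h'.1.symm
    · intro i ih hi hi'
      rw [h.2 i (succ_le_iff.1 hi), h'.2 i (succ_le_iff.1 hi'),
        ih ((lt_add_one' i).le.trans hi) ((lt_add_one' i).le.trans hi')]
  choose α β hαβ using hex
  refine ⟨fun n => entry (α n) (β n) n, ?_, (hαβ 0).1, fun i => ?_⟩
  -- The chosen codes `α`, `β` need not be definable; by `huniq` any code of a computation gives the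
  -- same value, which makes the graph `Σₖ`.
  · have : IsSigma k fun x : Fin 2 → M => ∃ a b, Q (x 1) a b ∧ x 0 = entry a b (x 1) :=
      .ex (.ex (.and (hQ' (.coord 3) (.coord 1) (.coord 0))
        (IsDelta.eq (.coord 2) (.entry (.coord 1) (.coord 0) (.coord 3))).1))
    refine (congrArg (IsSigma k) (funext fun x => propext ?_)).mp this
    constructor
    · rintro ⟨a, b, h, h'⟩
      exact h'.trans (huniq h (hαβ _) _ le_rfl le_rfl)
    · exact fun h => ⟨_, _, hαβ _, h⟩
  · dsimp only
    rw [(hαβ (i + 1)).2 i (lt_add_one' i),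
      huniq (hαβ (i + 1)) (hαβ i) i (lt_add_one' i).le le_rfl]

end Coding

end Arith

namespace Arith

/-! ### Powers of two, lengths and initial segments of strings. -/

section Exponential

variable {M : Type u} [CommSemiring M] [LinearOrder M] [PAMinus M]

lemma eq_zero_or_succ (x : M) : x = 0 ∨ ∃ y, x = y + 1 := by
  rcases eq_or_ne x 0 with h | h
  · exact Or.inl h
  · obtain ⟨y, rfl⟩ := exists_add_of_le (PAMinus.one_le_of_pos x (pos_iff_ne_zero.2 h))
    exact Or.inr ⟨y, add_comm _ _⟩

variable [Level M 1]

lemma exists_pw : ∃ F : M → M, DefFun 1 (fun x : Fin 1 → M => F (x 0)) ∧ F 0 = 1 ∧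
    ∀ i, F (i + 1) = 2 * F i :=
  exists_recursion (k := 1) (G := fun _ v => 2 * v) (.mul (.const 2) (.coord 1)) 1

/-- The exponential function `2 ^ n` of `M`. -/
noncomputable def pw : M → M := exists_pw.choose

lemma pw_zero : pw (0 : M) = 1 := exists_pw.choose_spec.2.1

lemma pw_succ (n : M) : pw (n + 1) = 2 * pw n := exists_pw.choose_spec.2.2 n

lemma DefFun.pw {k n : ℕ} [Level M k] {f : (Fin n → M) → M} (hf : DefFun k f) :
    DefFun k fun x => pw (f x) :=
  .comp₁ (DefFun.mono (Level.pos M) exists_pw.choose_spec.1) hf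

lemma pw_add (a b : M) : pw (a + b) = pw a * pw b := by
  revert b
  refine sigma_induction (k := 1) ?_ (by simp [pw_zero]) fun b ih => ?_
  · exact (IsDelta.eq (.pw (.add (.const a) (.coord 0))) (.mul (.const _) (.pw (.coord 0)))).1
  · rw [← add_assoc, pw_succ, pw_succ, ih]; ring

lemma lt_pw (n : M) : n < pw n := by
  revert n
  refine sigma_induction (k := 1) ?_ (by simp [pw_zero]) fun b ih => ?_
  · exact (IsDelta.lt (.coord 0) (.pw (.coord 0))).1
  · rw [pw_succ, two_mul]
    exact add_lt_add_of_lt_of_le ih (PAMinus.one_le_of_pos _ (zero_le.trans_lt ih))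

lemma pw_pos (n : M) : 0 < pw n := zero_le.trans_lt (lt_pw n)

lemma one_le_pw (n : M) : 1 ≤ pw n := PAMinus.one_le_of_pos _ (pw_pos n)

lemma pw_le {a b : M} (h : a ≤ b) : pw a ≤ pw b := by
  obtain ⟨c, rfl⟩ := exists_add_of_le h
  rw [pw_add]
  exact le_mul_of_one_le_right zero_le (one_le_pw c)

lemma lt_of_pw_lt {a b : M} (h : pw a < pw b) : a < b := by
  by_contra! hab
  exact absurd h (not_lt.2 (pw_le hab))

lemma isTwoPow_iff {n p : M} : IsTwoPow n p ↔ p = pw n := by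
  simp only [IsTwoPow, beta_iff]
  constructor
  · rintro ⟨a, b, h0, hs, rfl⟩
    have : ∀ i, i ≤ n → entry a b i = pw i := by
      refine sigma_induction (k := 1) ?_ (fun _ => by rw [← h0, pw_zero]) fun i ih hi => ?_
      · exact (IsDelta.imp (.le (.coord 0) (.const n)) (.eq (.entry (.const a) (.const b) (.coord 0))
          (.pw (.coord 0)))).1
      · obtain ⟨v, rfl, h⟩ := hs i (succ_le_iff.1 hi)
        rw [← h, ih ((lt_add_one' i).le.trans hi), pw_succ]
    exact this n le_rfl
  · rintro rfl
    obtain ⟨a, b, h⟩ := exists_code (k := 1) (F := fun i : M => pw i) (.pw (.coord 0)) (n + 1)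
    refine ⟨a, b, ?_, fun i hi => ⟨_, rfl, ?_⟩, (h n (lt_add_one' n)).symm⟩
    · rw [h 0 (zero_lt_one.trans_le le_add_self), pw_zero]
    · rw [h i (hi.trans (lt_add_one' n)), h (i + 1) (by gcongr), pw_succ]

lemma hasLength_iff {s n : M} : HasLength s n ↔ pw n ≤ s ∧ s < 2 * pw n := by
  simp [HasLength, isTwoPow_iff]

lemma isPrefix_iff {s t : M} : IsPrefix s t ↔ ∃ k r, r < pw k ∧ t = s * pw k + r := by
  simp [IsPrefix, isTwoPow_iff]

lemma exists_hasLength {s : M} (hs : 0 < s) : ∃ n, HasLength s n := by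
  obtain ⟨n, hn, hmin⟩ := exists_least_of_sigma (k := 1) (P := fun n => s < 2 * pw n)
    (IsDelta.lt (.const s) (.mul (.const 2) (.pw (.coord 0)))).1
    ⟨s, by rw [← pw_succ]; exact (lt_add_one' s).trans (lt_pw _)⟩
  refine ⟨n, hasLength_iff.2 ⟨?_, hn⟩⟩
  rcases eq_zero_or_succ n with rfl | ⟨m, rfl⟩
  · rw [pw_zero]; exact PAMinus.one_le_of_pos s hs
  · rw [pw_succ]; exact not_lt.1 (hmin m (lt_add_one' m))

lemma HasLength.unique {s n m : M} (h : HasLength s n) (h' : HasLength s m) : n = m := by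
  rw [hasLength_iff, ← pw_succ] at h h'
  exact le_antisymm (lt_succ_iff.1 (lt_of_pw_lt (h.1.trans_lt h'.2)))
    (lt_succ_iff.1 (lt_of_pw_lt (h'.1.trans_lt h.2)))

lemma hasLength_append {s n k r : M} (h : HasLength s n) (hr : r < pw k) :
    HasLength (s * pw k + r) (n + k) := by
  rw [hasLength_iff] at *
  obtain ⟨h₁, h₂⟩ := h
  rw [pw_add]
  constructor
  · exact le_add_right (by gcongr)
  · calc s * pw k + r < s * pw k + pw k := by gcongr
      _ = (s + 1) * pw k := by ring
      _ ≤ 2 * pw n * pw k := by have := succ_le_iff.2 h₂; gcongr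
      _ = _ := by ring

lemma hasLength_prefix {s n k r : M} (hr : r < pw k) (h : HasLength (s * pw k + r) (n + k)) :
    HasLength s n := by
  rw [hasLength_iff, pw_add] at *
  obtain ⟨h₁, h₂⟩ := h
  constructor
  · rw [← lt_succ_iff]
    refine lt_of_mul_lt_mul_right (a := pw k) ?_ zero_le
    calc pw n * pw k ≤ s * pw k + r := h₁
      _ < s * pw k + pw k := by gcongr
      _ = _ := by ring
  · refine lt_of_mul_lt_mul_right (a := pw k) ?_ zero_le
    calc s * pw k ≤ s * pw k + r := le_self_add
      _ < _ := h₂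
      _ = _ := by ring

end Exponential

/-! ### Finite cardinality, the pigeonhole principle and bounded comprehension. -/

section Counting

variable {M : Type u} [CommSemiring M] [LinearOrder M] [PAMinus M] [Level M 1]

lemma hasAtLeast_iff {A : Set M} {c : M} : HasAtLeast A c ↔ ∃ a b, (∀ i < c, entry a b i ∈ A) ∧
    ∀ i < c, ∀ j < c, entry a b i = entry a b j → i = j := by
  simp [HasAtLeast, beta_iff]

omit [Level M 1] in
lemma hasAtLeast_zero (A : Set M) : HasAtLeast A 0 :=
  ⟨0, 0, fun _ h => absurd h not_lt_zero, fun _ h => absurd h not_lt_zero⟩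

omit [PAMinus M] [Level M 1] in
lemma HasAtLeast.mono {A B : Set M} {c : M} (h : HasAtLeast A c) (hAB : ∀ x ∈ A, x ∈ B) :
    HasAtLeast B c := by
  obtain ⟨a, b, h₁, h₂⟩ := h
  refine ⟨a, b, fun i hi => ?_, h₂⟩
  obtain ⟨x, hx, h⟩ := h₁ i hi
  exact ⟨x, hAB x hx, h⟩

lemma hasAtLeast_of_injOn {k : ℕ} [Level M k] {A : Set M} {c : M} {F : M → M}
    (hF : DefFun k fun x : Fin 1 → M => F (x 0)) (hA : ∀ i < c, F i ∈ A)
    (hinj : ∀ i < c, ∀ j < c, F i = F j → i = j) : HasAtLeast A c := by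
  obtain ⟨a, b, h⟩ := exists_code hF c
  refine hasAtLeast_iff.2 ⟨a, b, fun i hi => h i hi ▸ hA i hi, fun i hi j hj hij => ?_⟩
  exact hinj i hi j hj (by rwa [h i hi, h j hj] at hij)

lemma HasAtLeast.map {k : ℕ} [Level M k] {A B : Set M} {c : M} (h : HasAtLeast A c) {f : M → M}
    (hf : DefFun k fun x : Fin 1 → M => f (x 0)) (hB : ∀ x ∈ A, f x ∈ B)
    (hinj : ∀ x ∈ A, ∀ y ∈ A, f x = f y → x = y) : HasAtLeast B c := by
  obtain ⟨a, b, h₁, h₂⟩ := hasAtLeast_iff.1 h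
  refine hasAtLeast_of_injOn (F := fun i => f (entry a b i))
    (hf.comp₁ (.entry (.const a) (.const b) (.coord 0))) (fun i hi => hB _ (h₁ i hi)) ?_
  exact fun i hi j hj hij => h₂ i hi j hj (hinj _ (h₁ i hi) _ (h₁ j hj) hij)

lemma HasAtLeast.insert {A B : Set M} {c x : M} (h : HasAtLeast A c) (hAB : ∀ x ∈ A, x ∈ B)
    (hx : x ∈ B) (hxA : x ∉ A) : HasAtLeast B (c + 1) := by
  classical
  obtain ⟨a, b, h₁, h₂⟩ := hasAtLeast_iff.1 h
  refine hasAtLeast_of_injOn (k := 1) (F := fun i => if i < c then entry a b i else x)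
    (.ite (.lt (.coord 0) (.const c)) (.entry (.const a) (.const b) (.coord 0)) (.const x)) ?_ ?_
  · intro i _
    by_cases hi : i < c
    · simpa [hi] using hAB _ (h₁ i hi)
    · simpa [hi] using hx
  · intro i hi j hj hij
    by_cases hi' : i < c <;> by_cases hj' : j < c <;> simp only [hi', hj', if_true, if_false] at hij
    · exact h₂ i hi' j hj' hij
    · exact absurd (hij ▸ h₁ i hi') hxA
    · exact absurd (hij ▸ h₁ j hj') hxA
    · exact (le_antisymm (lt_succ_iff.1 hi) (not_lt.1 hi')).trans
        (le_antisymm (not_lt.1 hj') (lt_succ_iff.1 hj))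

lemma IsSigma.hasAtLeast {k n : ℕ} [Level M k] {R : (Fin n → M) → M → Prop}
    (hR : IsSigma k fun x : Fin (n + 1) → M => R (Fin.tail x) (x 0)) {f : (Fin n → M) → M}
    (hf : DefFun k f) : IsSigma k fun x => HasAtLeast {z | R x z} (f x) := by
  simp only [hasAtLeast_iff]
  refine .ex (.ex (.and (.ball hf.tail.tail ?_) (.ball hf.tail.tail (.ball hf.tail.tail.tail ?_))))
  · have := hR.comp (F := fun x : Fin (n + 3) → M =>
      Fin.cons (entry (x 2) (x 1) (x 0)) (Fin.tail (Fin.tail (Fin.tail x)))) fun i => by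
        refine Fin.cases ?_ (fun i => ?_) i
        · exact .entry (.coord 2) (.coord 1) (.coord 0)
        · exact .coord i.succ.succ.succ
    simp only [Fin.cons_zero, Fin.tail_cons] at this
    exact this
  · exact (IsDelta.imp (.eq (.entry (.coord 3) (.coord 2) (.coord 1))
      (.entry (.coord 3) (.coord 2) (.coord 0))) (.eq (.coord 1) (.coord 0))).1

/-- `C x` is the number of elements of `A` below `x`. -/
structure Counts (A : Set M) (C : M → M) : Prop where
  zero : C 0 = 0
  mem : ∀ x ∈ A, C (x + 1) = C x + 1
  notMem : ∀ x ∉ A, C (x + 1) = C x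

variable {k : ℕ} [Level M k]

lemma exists_counts {A : Set M} (hA : IsDelta k fun x : Fin 1 → M => x 0 ∈ A) :
    ∃ C : M → M, DefFun k (fun x : Fin 1 → M => C (x 0)) ∧ Counts A C := by
  classical
  obtain ⟨C, hC, h0, hs⟩ := exists_recursion (k := k)
    (G := fun i v => if i ∈ A then v + 1 else v) (.ite (hA.comp₁ (P := fun x => x ∈ A) (.coord 0))
      (.add (.coord 1) (.const 1)) (.coord 1)) 0
  exact ⟨C, hC, h0, fun x hx => by rw [hs, if_pos hx], fun x hx => by rw [hs, if_neg hx]⟩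

namespace Counts

variable {A : Set M} {C : M → M}

omit [Level M 1] in
lemma le_succ (h : Counts A C) (x : M) : C x ≤ C (x + 1) := by
  by_cases hx : x ∈ A
  · rw [h.mem x hx]; exact le_self_add
  · rw [h.notMem x hx]

omit [Level M 1] in
lemma mono (hC : DefFun k fun x : Fin 1 → M => C (x 0)) (h : Counts A C) {x y : M} (hxy : x ≤ y) :
    C x ≤ C y := by
  obtain ⟨z, rfl⟩ := exists_add_of_le hxy
  clear hxy
  revert z
  refine sigma_induction (k := k) ?_ (by simp) fun z ih => ?_
  · exact (IsDelta.le (.const _) (hC.comp₁ (.add (.const x) (.coord 0)))).1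
  · rw [← add_assoc]; exact ih.trans (h.le_succ _)

/-- The pigeonhole principle. -/
lemma le_of_hasAtLeast (hA : IsSigma k fun x : Fin 1 → M => x 0 ∈ A)
    (hC : DefFun k fun x : Fin 1 → M => C (x 0)) (h : Counts A C) {u v c : M} (huv : u ≤ v)
    (hc : HasAtLeast {z | z ∈ A ∧ u ≤ z ∧ z < v} c) : c + C u ≤ C v := by
  classical
  obtain ⟨y, rfl⟩ := exists_add_of_le huv
  clear huv
  revert c
  revert y
  -- `HasAtLeast` is `Σₖ` and occurs here as a hypothesis for every `c`, so the claim is `Πₖ` in the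
  -- length `y` of the interval.
  refine pi_induction (k := k) ?_ ?_ ?_
  · have : IsSigma k fun x : Fin 1 → M =>
        ∃ c, HasAtLeast {z | z ∈ A ∧ u ≤ z ∧ z < u + x 0} c ∧ C (u + x 0) < c + C u := by
      refine .ex (.and ?_ (IsDelta.lt (hC.comp₁ (.add (.const u) (.coord 1)))
        (.add (.coord 0) (.const _))).1)
      refine .hasAtLeast (R := fun x z => z ∈ A ∧ u ≤ z ∧ z < u + x 1) ?_ (.coord 0)
      exact .and (hA.comp₁ (P := fun z => z ∈ A) (.coord 0))
        (IsDelta.and (.le (.const u) (.coord 0)) (.lt (.coord 0) (.add (.const u) (.coord 2)))).1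
    simpa using this
  · intro c hc
    rcases eq_zero_or_succ c with rfl | ⟨c, rfl⟩
    · simp
    · obtain ⟨a, b, h₁, -⟩ := hasAtLeast_iff.1 hc
      obtain ⟨-, h₂, h₃⟩ := h₁ 0 (zero_lt_one.trans_le le_add_self)
      exact absurd h₃ (by simpa using h₂)
  · intro y ih c hc
    obtain ⟨a, b, h₁, h₂⟩ := hasAtLeast_iff.1 hc
    rw [← add_assoc]
    by_cases hy : ∃ i₀ < c, entry a b i₀ = u + y
    · obtain ⟨i₀, hi₀, hy⟩ := hy
      have hyA : u + y ∈ A := hy ▸ (h₁ i₀ hi₀).1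
      obtain rfl | ⟨c, rfl⟩ := eq_zero_or_succ c
      · exact absurd hi₀ not_lt_zero
      have hlt : ∀ j < c + 1, j ≠ i₀ → entry a b j ∈ {z | z ∈ A ∧ u ≤ z ∧ z < u + y} := by
        intro j hj hne
        obtain ⟨hA, hu, hlt⟩ := h₁ j hj
        rw [← add_assoc, lt_succ_iff] at hlt
        exact ⟨hA, hu, hlt.lt_of_ne fun h => hne (h₂ j hj i₀ hi₀ (h.trans hy.symm))⟩
      -- The last entry is moved to the place `i₀` that held `u + y`, which leaves `c` distinct
      -- elements below `u + y`.
      have := ih (c := c) (hasAtLeast_of_injOn (k := 1)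
        (F := fun i => if i = i₀ then entry a b c else entry a b i) (.ite (.eq (.coord 0) (.const _))
          (.const _) (.entry (.const a) (.const b) (.coord 0))) ?_ ?_)
      · rw [h.mem _ hyA, add_right_comm]; gcongr
      · intro i hi
        by_cases hii : i = i₀
        · subst hii; simpa using hlt c (lt_add_one' c) hi.ne'
        · simpa [hii] using hlt i (hi.trans (lt_add_one' c)) hii
      · intro i hi j hj hij
        have hi' := hi.trans (lt_add_one' c)
        have hj' := hj.trans (lt_add_one' c)
        by_cases hii : i = i₀ <;> by_cases hjj : j = i₀ <;>
          simp only [hii, hjj, if_true, if_false] at hij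
        · exact hii.trans hjj.symm
        · exact absurd (h₂ _ (lt_add_one' c) j hj' hij) hj.ne'
        · exact absurd (h₂ _ hi' _ (lt_add_one' c) hij) hi.ne
        · exact h₂ _ hi' _ hj' hij
    · push Not at hy
      refine (ih (c := c) (hasAtLeast_iff.2 ⟨a, b, fun i hi => ?_, h₂⟩)).trans (h.le_succ _)
      obtain ⟨hA, hu, hlt⟩ := h₁ i hi
      rw [← add_assoc, lt_succ_iff] at hlt
      exact ⟨hA, hu, hlt.lt_of_ne (hy i hi)⟩

lemma hasAtLeast (hA : IsSigma k fun x : Fin 1 → M => x 0 ∈ A)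
    (hC : DefFun k fun x : Fin 1 → M => C (x 0)) (h : Counts A C) {u v : M} (huv : u ≤ v) :
    ∃ c, C v = C u + c ∧ HasAtLeast {z | z ∈ A ∧ u ≤ z ∧ z < v} c := by
  obtain ⟨y, rfl⟩ := exists_add_of_le huv
  clear huv
  revert y
  refine sigma_induction (k := k) ?_ ⟨0, by simp, hasAtLeast_zero _⟩ ?_
  · refine .ex (.and (IsDelta.eq (hC.comp₁ (.add (.const u) (.coord 1)))
        (.add (.const _) (.coord 0))).1 ?_)
    refine .hasAtLeast (R := fun x z => z ∈ A ∧ u ≤ z ∧ z < u + x 1) ?_ (.coord 0)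
    exact .and (hA.comp₁ (P := fun z => z ∈ A) (.coord 0))
      (IsDelta.and (.le (.const u) (.coord 0)) (.lt (.coord 0) (.add (.const u) (.coord 2)))).1
  · rintro y ⟨c, hc, hy⟩
    have hsub : ∀ z ∈ {z | z ∈ A ∧ u ≤ z ∧ z < u + y},
        z ∈ {z | z ∈ A ∧ u ≤ z ∧ z < u + (y + 1)} := fun z ⟨h₁, h₂, h₃⟩ =>
      ⟨h₁, h₂, by rw [← add_assoc]; exact h₃.trans (lt_add_one' _)⟩
    by_cases hyA : u + y ∈ A
    · refine ⟨c + 1, by rw [← add_assoc, h.mem _ hyA, hc, add_assoc], ?_⟩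
      exact hy.insert hsub ⟨hyA, le_self_add, by rw [← add_assoc]; exact lt_add_one' _⟩
        fun h => lt_irrefl _ h.2.2
    · exact ⟨c, by rw [← add_assoc, h.notMem _ hyA, hc], hy.mono hsub⟩

end Counts

lemma le_of_hasAtLeast_Ico {u v c : M} (huv : u ≤ v) (h : HasAtLeast {z | u ≤ z ∧ z < v} c) :
    c + u ≤ v := by
  have hC : Counts (Set.univ : Set M) fun x => x :=
    ⟨rfl, fun _ _ => rfl, fun x hx => absurd (Set.mem_univ x) hx⟩
  have hA : IsSigma 1 fun x : Fin 1 → M => x 0 ∈ (Set.univ : Set M) := by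
    simpa using (IsDelta.eq (k := 1) (f := fun x : Fin 1 → M => x 0) (.coord 0) (.coord 0)).1
  exact hC.le_of_hasAtLeast (k := 1) hA (.coord 0) huv (h.mono fun z hz => ⟨Set.mem_univ z, hz⟩)

lemma le_of_hasAtLeast_lt {x c : M} (h : HasAtLeast {z | z < x} c) : c ≤ x := by
  simpa using le_of_hasAtLeast_Ico (zero_le (a := x)) (h.mono fun z hz => ⟨zero_le, hz⟩)

/-- Bounded comprehension: an initial part of a `Σₖ` set is coded in `M`. -/
lemma exists_delta_eq {A : Set M} (hA : IsSigma k fun x : Fin 1 → M => x 0 ∈ A) (u : M) :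
    ∃ B : Set M, IsDelta 1 (fun x : Fin 1 → M => x 0 ∈ B) ∧ ∀ x < u, x ∈ A ↔ x ∈ B := by
  -- An enumeration of maximal length omits no element of `A` below `u`, so its range, which is `Δ₁`
  -- in the code, is that part of `A`.
  obtain ⟨c, hc, hmax⟩ : ∃ c, HasAtLeast {z | z ∈ A ∧ z < u} c ∧
      ¬ HasAtLeast {z | z ∈ A ∧ z < u} (c + 1) := by
    by_contra! hn
    have := sigma_induction (k := k) (P := fun c => HasAtLeast {z | z ∈ A ∧ z < u} c)
      (.hasAtLeast (.and (hA.comp₁ (P := fun z => z ∈ A) (.coord 0))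
        (IsDelta.lt (.coord 0) (.const u)).1) (.coord 0)) (hasAtLeast_zero _) hn (u + 1)
    exact absurd (le_of_hasAtLeast_lt (this.mono fun z hz => hz.2)) (not_le.2 (lt_add_one' u))
  obtain ⟨a, b, h₁, h₂⟩ := hasAtLeast_iff.1 hc
  refine ⟨{z | ∃ i < c, entry a b i = z}, ?_, fun x hx => ⟨fun hxA => ?_, ?_⟩⟩
  · exact .bex (.const c) (.eq (.entry (.const a) (.const b) (.coord 0)) (.coord 1))
  · by_contra hxB
    have hc' : HasAtLeast {z | (z ∈ A ∧ z < u) ∧ ∃ i < c, entry a b i = z} c :=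
      hasAtLeast_iff.2 ⟨a, b, fun i hi => ⟨h₁ i hi, i, hi, rfl⟩, h₂⟩
    exact hmax (hc'.insert (fun z hz => hz.1) ⟨hxA, hx⟩ fun h => hxB h.2)
  · rintro ⟨i, hi, rfl⟩
    exact (h₁ i hi).1

lemma exists_codesOracle {Y : Set M} (hY : IsSigma k fun x : Fin 1 → M => x 0 ∈ Y) (u : M) :
    ∃ a b, CodesOracle Y a b u := by
  classical
  obtain ⟨B, hB, h⟩ := exists_delta_eq hY u
  obtain ⟨a, b, hab⟩ := exists_code (k := 1) (F := fun i => if i ∈ B then 1 else 0)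
    (.ite hB (.const 1) (.const 0)) u
  refine ⟨a, b, fun i hi => ?_⟩
  rw [h i hi, beta_iff, beta_iff, hab i hi]
  by_cases hiB : i ∈ B <;> simp [hiB]

end Counting

end Arith

namespace Arith

/-! ### Lebesgue density from `IΣ₂`. -/

section Density

variable {M : Type u} [CommSemiring M] [LinearOrder M] [PAMinus M] [Level M 1]

omit [PAMinus M] [Level M 1] in
lemma IsSigma.isDelta_succ {k n : ℕ} [Closed M k] {R : (Fin n → M) → Prop} (h : IsSigma k R) :
    IsDelta (k + 1) R := ⟨h.succ, h.not_succ⟩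

/-- Agreement with a c.e. oracle is `Δ₂`, and both membership and non-membership in `T` assert the
existence of a computation. -/
lemma isDelta_two_of_zeroJump [Level M 2] {T : Set M} (hT : IsZeroJumpComputable T) :
    IsDelta 2 fun x : Fin 1 → M => x 0 ∈ T := by
  obtain ⟨Y, hY, Φ, hΦ, h⟩ := hT
  have hY' : IsDelta 2 fun x : Fin 1 → M => x 0 ∈ Y := IsSigma.isDelta_succ (k := 1) hY
  have key : ∀ j : M, IsSigma 2 fun x : Fin 1 → M =>
      ∃ a b u : M, CodesOracle Y a b u ∧ Φ ![x 0, j, a, b, u] := by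
    intro j
    refine .ex (.ex (.ex (.and ?_ ?_)))
    · simp only [CodesOracle, beta_iff]
      have he : DefFun 2 fun x : Fin 5 → M => entry (x 3) (x 2) (x 0) :=
        .entry (.coord 3) (.coord 2) (.coord 0)
      have hm : IsDelta 2 fun x : Fin 5 → M => x 0 ∈ Y :=
        hY'.comp₁ (P := fun z => z ∈ Y) (.coord 0)
      exact (IsDelta.ball (.coord 0) (.or (.and hm (.eq (.const 1) he))
        (.and hm.not (.eq (.const 0) he)))).1
    · refine (IsSigma.succ hΦ).comp (F := fun x : Fin 4 → M => ![x 3, j, x 2, x 1, x 0]) fun i => ?_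
      fin_cases i
      exacts [.coord 3, .const j, .coord 2, .coord 1, .coord 0]
  refine ⟨?_, ?_⟩
  · simpa only [← (h _).1] using key 1
  · simpa only [← (h _).2] using key 0

lemma IsTree.of_double {T : Set M} (hT : IsTree T) {x r : M} (hx : 0 < x) (hr : r < 2)
    (h : 2 * x + r ∈ T) : x ∈ T := by
  refine hT.2 x _ hx (isPrefix_iff.2 ⟨1, r, ?_, ?_⟩) h
  · rw [← zero_add (1 : M), pw_succ, pw_zero]; simpa using hr
  · rw [← zero_add (1 : M), pw_succ, pw_zero]; ring

variable {k : ℕ} [Level M k] {T : Set M} {C : M → M}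

/-- An element of `T` in `[2x, 2y)` is a child of an element of `T` in `[x, y)`, and each string has
only two children. -/
lemma Counts.double_le (hT : IsTree T) (hC : DefFun k fun x : Fin 1 → M => C (x 0))
    (h : Counts T C) {x y : M} (hx : 0 < x) (hxy : x ≤ y) :
    C (2 * y) + 2 * C x ≤ 2 * C y + C (2 * x) := by
  obtain ⟨z, rfl⟩ := exists_add_of_le hxy
  clear hxy
  revert z
  refine sigma_induction (k := k) ?_ (by simp [add_comm]) fun z ih => ?_
  · exact (IsDelta.le (.add (hC.comp₁ (.mul (.const 2) (.add (.const x) (.coord 0)))) (.const _))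
      (.add (.mul (.const 2) (hC.comp₁ (.add (.const x) (.coord 0)))) (.const _))).1
  · have e : 2 * (x + (z + 1)) = 2 * (x + z) + 1 + 1 := by ring
    rw [e, ← add_assoc x]
    have hz : 0 < x + z := hx.trans_le le_self_add
    by_cases hm : x + z ∈ T
    · have h₁ : C (2 * (x + z) + 1 + 1) ≤ C (2 * (x + z) + 1) + 1 := by
        by_cases h' : 2 * (x + z) + 1 ∈ T
        · rw [h.mem _ h']
        · rw [h.notMem _ h']; exact le_self_add
      have h₂ : C (2 * (x + z) + 1) ≤ C (2 * (x + z)) + 1 := by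
        by_cases h' : 2 * (x + z) ∈ T
        · rw [h.mem _ h']
        · rw [h.notMem _ h']; exact le_self_add
      rw [h.mem _ hm]
      rw [Diff.of_le] at *
      simp only [map_add, map_mul, map_ofNat, map_one] at *
      linarith
    · rw [h.notMem _ hm, h.notMem, h.notMem]
      · exact ih
      · exact fun h' => hm (hT.of_double (r := 0) hz two_pos (by simpa using h'))
      · exact fun h' => hm (hT.of_double (r := 1) hz one_lt_two h')

/-- The part of `T` above `[a, x)` has at most `g * p / f` times as many elements at the level
reached by the factor `p` as it has at the level of `a`. -/
def Sparse (C : M → M) (f g a x p : M) : Prop :=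
  f * C (x * p) + g * p * C a ≤ g * p * C x + f * C (a * p)

-- Both sides telescope, so sparsity above single strings adds up to sparsity above an interval,
-- provided the factor `p` is the same.
omit [Level M 1] [Level M k] in
lemma Sparse.trans {f g a x y p : M} (h₁ : Sparse C f g a x p) (h₂ : Sparse C f g x y p) :
    Sparse C f g a y p := by
  unfold Sparse at *
  grind

/-- One level further up, the allowed number doubles while the actual number at most doubles. Hence
different strings can be given a common `m`. -/
lemma Sparse.mono (hT : IsTree T) (hC : DefFun k fun x : Fin 1 → M => C (x 0))
    (h : Counts T C) {f g a x m m' : M} (ha : 0 < a) (hax : a ≤ x) (hs : Sparse C f g a x (pw m))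
    (hm : m ≤ m') : Sparse C f g a x (pw m') := by
  obtain ⟨j, rfl⟩ := exists_add_of_le hm
  clear hm
  revert j
  refine sigma_induction (k := k) ?_ (by simpa using hs) fun j ih => ?_
  · have hp : DefFun k fun x : Fin 1 → M => pw (m + x 0) := .pw (.add (.const m) (.coord 0))
    exact (IsDelta.le (.add (.mul (.const f) (hC.comp₁ (.mul (.const x) hp)))
      (.mul (.mul (.const g) hp) (.const _))) (.add (.mul (.mul (.const g) hp) (.const _))
        (.mul (.const f) (hC.comp₁ (.mul (.const a) hp))))).1
  · rw [← add_assoc, pw_succ]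
    have hd := h.double_le hT hC (x := a * pw (m + j)) (y := x * pw (m + j))
      (mul_pos ha (pw_pos _)) (by gcongr)
    unfold Sparse at *
    rw [mul_left_comm x, mul_left_comm a]
    simp only [Diff.of_le, map_add, map_mul, map_ofNat] at *
    nlinarith [mul_le_mul_of_nonneg_left hd (Diff.of_nonneg f)]

/-- Here `g / (2f) = 1 - ε/2`. Halving `ε` makes the lower bound `(1 - ε/2) 2^(-n)` strictly greater
than `(1 - ε) 2^(-n)`, as `DenseAt` demands. -/
lemma denseAt_of_forall_lt (hT : IsTree T) (hA : IsSigma k fun x : Fin 1 → M => x 0 ∈ T)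
    (hC : DefFun k fun x : Fin 1 → M => C (x 0)) (h : Counts T C) {e f g σ n : M}
    (he : 0 < e) (hf : 0 < f) (hg : 2 * f = g + e) (hσ : HasLength σ n)
    (hs : ∀ m, ¬ Sparse C (2 * f) g σ (σ + 1) (pw m)) : DenseAt T σ e f := by
  -- If `σ ∉ T`, then nothing is counted at `σ` and sparsity holds trivially for `m = 0`.
  have hσT : σ ∈ T := by
    by_contra hσT
    apply hs 0
    simp [Sparse, pw_zero, h.notMem σ hσT, add_comm]
  refine ⟨n, pw n, g, 2 * f * pw n, hσ, isTwoPow_iff.2 rfl,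
    mul_pos (mul_pos two_pos hf) (pw_pos n), ?_, ?_⟩
  · have hpos := mul_pos (mul_pos he hf) (pw_pos n)
    calc f * (2 * f * pw n) < f * (2 * f * pw n) + e * f * pw n := lt_add_of_pos_right _ hpos
      _ = f * ((g + e) * pw n) + e * f * pw n := by rw [hg]
      _ = _ := by ring
  · intro l q hq
    obtain rfl := isTwoPow_iff.1 hq
    rcases le_total n l with hnl | hnl
    · obtain ⟨m, rfl⟩ := exists_add_of_le hnl
      obtain ⟨c, hc, hc'⟩ := h.hasAtLeast hA hC (u := σ * pw m) (v := (σ + 1) * pw m)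
        (by gcongr; exact le_self_add)
      refine ⟨c, hc'.mono ?_, ?_⟩
      · rintro z ⟨hz, hz₁, hz₂⟩
        obtain ⟨r, rfl⟩ := exists_add_of_le hz₁
        have hr : r < pw m := by rw [add_mul, one_mul] at hz₂; exact lt_of_add_lt_add_left hz₂
        exact ⟨⟨hz, Or.inr (isPrefix_iff.2 ⟨m, r, hr, rfl⟩)⟩, hasLength_append hσ hr⟩
      · have := hs m
        rw [Sparse, not_le, h.mem σ hσT, hc] at this
        rw [pw_add]
        have hn := pw_pos n
        simp only [Diff.of_le, Diff.of_lt, map_add, map_mul, map_ofNat, map_one, map_zero] at *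
        nlinarith
    -- At a level no higher than `σ`, the initial segment of `σ` is one element of the restricted
    -- tree, and one suffices.
    · obtain ⟨m, rfl⟩ := exists_add_of_le hnl
      obtain ⟨s, r, hr, hsr⟩ := exists_div σ (pw_pos m)
      have hsl : HasLength s l := hasLength_prefix hr (hsr ▸ hσ)
      have hpre : IsPrefix s σ := isPrefix_iff.2 ⟨m, r, hr, hsr⟩
      have hsT : s ∈ T := hT.2 s σ ((pw_pos l).trans_le (hasLength_iff.1 hsl).1) hpre hσT
      refine ⟨0 + 1, (hasAtLeast_zero ∅).insert (x := s) (fun x hx => absurd hx (Set.notMem_empty x))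
        ⟨⟨hsT, Or.inl hpre⟩, hsl⟩ (Set.notMem_empty s), ?_⟩
      rw [zero_add, one_mul, hg]
      have := pw_le hnl
      gcongr
      exact le_self_add

lemma exists_denseAt_of_le (hT : IsTree T) (hA : IsSigma k fun x : Fin 1 → M => x 0 ∈ T)
    (hC : DefFun k fun x : Fin 1 → M => C (x 0)) (h : Counts T C) (hpos : MeasurePos T) {e f : M}
    (he : 0 < e) (hf : 0 < f) (hef : e ≤ f) : ∃ σ, 0 < σ ∧ DenseAt T σ e f := by
  by_contra! hn
  obtain ⟨c, d, hc, hd, hmeas⟩ := hpos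
  obtain ⟨g, hg⟩ : ∃ g, 2 * f = g + e := by
    obtain ⟨g, rfl⟩ := exists_add_of_le hef
    exact ⟨e + 2 * g, by ring⟩
  have hlow : ∀ l, c * pw l + d * C (pw l) ≤ d * C (2 * pw l) := by
    intro l
    obtain ⟨j, hj, hj'⟩ := hmeas l (pw l) (isTwoPow_iff.2 rfl)
    have := h.le_of_hasAtLeast hA hC (u := pw l) (v := 2 * pw l) (c := j)
      (le_mul_of_one_le_left zero_le one_le_two)
      (hj.mono fun z hz => ⟨hz.1, hasLength_iff.1 hz.2⟩)
    calc c * pw l + d * C (pw l) ≤ j * d + d * C (pw l) := by gcongr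
      _ = d * (j + C (pw l)) := by ring
      _ ≤ _ := by gcongr
  have hpC : DefFun k fun x : Fin 2 → M => C (pw (x 0)) := hC.comp₁ (.pw (.coord 0))
  -- Level densities are measured in units of `1 / (2fd)`, at most `ε/2` times the lower bound `c /
  -- d` since `e` and `c` are at least `1`. For the least `j = i + 1`, level `n` has density below
  -- `(i + 1) / (2fd)` and every level has density at least `i / (2fd)`.
  obtain ⟨j, ⟨n, hn₁⟩, hmin⟩ := exists_least_of_sigma (k := k)
    (P := fun j => ∃ l, 2 * f * d * C (2 * pw l) < j * pw l + 2 * f * d * C (pw l))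
    (.ex (IsDelta.lt (.mul (.const _) (hC.comp₁ (.mul (.const 2) (.pw (.coord 0)))))
      (.add (.mul (.coord 1) (.pw (.coord 0))) (.mul (.const _) hpC))).1)
    -- Level `0` has at most one string, hence density at most `1 = 2fd / (2fd)`.
    ⟨2 * f * d + 1, 0, by
      have : C (1 + 1) ≤ C 1 + 1 := by
        by_cases h' : 1 ∈ T
        · rw [h.mem _ h']
        · rw [h.notMem _ h']; exact le_self_add
      rw [pw_zero, mul_one, mul_one, ← one_add_one_eq_two]
      calc (1 + 1) * f * d * C (1 + 1) ≤ (1 + 1) * f * d * (C 1 + 1) := by gcongr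
        _ < (1 + 1) * f * d * (C 1 + 1) + 1 := lt_add_one' _
        _ = _ := by ring⟩
  obtain rfl | ⟨i, rfl⟩ := eq_zero_or_succ j
  · refine absurd hn₁ (not_lt.2 ?_)
    rw [zero_mul, zero_add]
    have := h.mono hC (x := pw n) (y := 2 * pw n) (le_mul_of_one_le_left zero_le one_le_two)
    gcongr
  have hi : ∀ l, i * pw l + 2 * f * d * C (pw l) ≤ 2 * f * d * C (2 * pw l) := fun l =>
    not_lt.1 fun hl => hmin i (lt_add_one' i) ⟨l, hl⟩
  have hstep : ∀ σ, HasLength σ n → ∃ m, Sparse C (2 * f) g σ (σ + 1) (pw m) := by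
    intro σ hσ
    by_contra! hs
    exact hn σ ((pw_pos n).trans_le (hasLength_iff.1 hσ).1)
      (denseAt_of_forall_lt hT hA hC h he hf hg hσ hs)
  -- Passing through level `n` string by string and taking maxima yields one `m` for the whole
  -- level; the induction formula is `Σₖ`.
  have hall : ∀ y, pw n < y ∨ ∃ m, Sparse C (2 * f) g (pw n) (pw n + y) (pw m) := by
    refine sigma_induction (k := k) ?_ (Or.inr ⟨0, by simp [Sparse, add_comm]⟩) ?_
    · have hp : DefFun k fun x : Fin 2 → M => pw (x 0) := .pw (.coord 0)
      refine .or (IsDelta.lt (.const _) (.coord 0)).1 (.ex (IsDelta.le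
        (.add (.mul (.const _) (hC.comp₁ (.mul (.add (.const _) (.coord 1)) hp)))
          (.mul (.mul (.const g) hp) (.const _)))
        (.add (.mul (.mul (.const g) hp) (hC.comp₁ (.add (.const _) (.coord 1))))
          (.mul (.const _) (hC.comp₁ (.mul (.const _) hp))))).1)
    · rintro y (hy | ⟨m, hm⟩)
      · exact Or.inl (hy.trans (lt_add_one' y))
      rcases le_or_gt (pw n) y with hy | hy
      · exact Or.inl (hy.trans_lt (lt_add_one' y))
      obtain ⟨m', hm'⟩ := hstep (pw n + y) (hasLength_iff.2 ⟨le_self_add, by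
        rw [two_mul]; gcongr⟩)
      have hpos : 0 < pw n + y := (pw_pos n).trans_le le_self_add
      refine Or.inr ⟨max m m', ?_⟩
      rw [← add_assoc]
      exact (hm.mono hT hC h (pw_pos n) le_self_add (le_max_left m m')).trans
        (hm'.mono hT hC h hpos (lt_add_one' _).le (le_max_right m m'))
  obtain ⟨m, hm⟩ := (hall (pw n)).resolve_left (lt_irrefl _)
  have h₁ := hlow n
  have h₂ := hi (n + m)
  have hpn := pw_pos n
  have hpm := pw_pos m
  rw [pw_add] at h₂
  rw [← two_mul, Sparse] at hm
  rw [mul_assoc 2 (pw n)] at hm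
  have he₁ := PAMinus.one_le_of_pos e he
  have hc₁ := PAMinus.one_le_of_pos c hc
  clear hall hstep hi hlow hmin hn hmeas hef hpC
  generalize C (2 * (pw n * pw m)) = c₁ at *
  generalize C (pw n * pw m) = c₂ at *
  generalize C (2 * pw n) = c₃ at *
  generalize C (pw n) = c₄ at *
  simp only [Diff.of_le, Diff.of_lt, Diff.of_inj, map_add, map_mul, map_ofNat, map_one,
    map_zero] at *
  have hg₀ := Diff.of_nonneg g
  have hi₀ := Diff.of_nonneg i
  generalize Diff.of c₁ = c₁ at *
  generalize Diff.of c₂ = c₂ at *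
  generalize Diff.of c₃ = c₃ at *
  generalize Diff.of c₄ = c₄ at *
  generalize Diff.of (pw n) = a at *
  generalize Diff.of (pw m) = p at *
  generalize Diff.of c = c at *
  generalize Diff.of d = d at *
  generalize Diff.of e = e at *
  generalize Diff.of f = f at *
  generalize Diff.of g = g at *
  generalize Diff.of i = i at *
  -- Level `n` has density at least `c / d`, so `i + 1 > 2fc ≥ 2f`.
  have hbig : 2 * f < i + 1 := by
    have h₃ : 2 * f * c < i + 1 := by
      refine lt_of_mul_lt_mul_right (a := a * d) ?_ (by positivity)
      nlinarith [mul_le_mul_of_nonneg_left h₁ (by positivity : 0 ≤ 2 * f * d),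
        mul_lt_mul_of_pos_right hn₁ hd]
    nlinarith
  -- The density of level `n + m` is at least `i / (2fd)` and at most `g / (2f)` times `(i + 1) /
  -- (2fd)`. With `2f = g + e` this gives `e (i + 1) ≤ 2f`, against `hbig`.
  have h₄ : 2 * f * i ≤ g * (i + 1) := by
    refine le_of_mul_le_mul_right (a := a * p) ?_ (by positivity)
    nlinarith [mul_le_mul_of_nonneg_left h₂ (by positivity : 0 ≤ 2 * f),
      mul_le_mul_of_nonneg_left hm (by positivity : 0 ≤ 2 * f * d),
      mul_le_mul_of_nonneg_left hn₁.le (by positivity : 0 ≤ g * p)]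
  nlinarith

omit [Level M 1] in
lemma DenseAt.mono {e e' f σ : M} (he : e ≤ e') (h : DenseAt T σ e f) : DenseAt T σ e' f := by
  obtain ⟨n, p, c, d, hσ, hp, hd, hlt, hm⟩ := h
  exact ⟨n, p, c, d, hσ, hp, hd, hlt.trans_le (by gcongr), hm⟩

theorem lebesgueDensity_of_level_two [Level M 2] : LebesgueDensity M := by
  intro T hT hcomp hpos e f he hf
  have hA := isDelta_two_of_zeroJump hcomp
  obtain ⟨C, hC, h⟩ := exists_counts hA
  -- Replacing `ε` by `min ε 1` ensures that `2f - e` exists in `M`.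
  obtain ⟨σ, hσ, hd⟩ := exists_denseAt_of_le hT hA.1 hC h hpos (lt_min he hf) hf (min_le_right e f)
  exact ⟨σ, hσ, hd.mono (min_le_left e f)⟩

end Density

end Arith

namespace Arith

/-! ### An unbounded `Π₁` set with few elements, from a failure of `IΣ₂`. -/

section SparseSet

variable {M : Type u} [CommSemiring M] [LinearOrder M]

lemma IsSigma.not_and {k n : ℕ} [Level M k] {R S : (Fin n → M) → Prop}
    (hR : IsSigma k fun x => ¬ R x) (hS : IsSigma k fun x => ¬ S x) :
    IsSigma k fun x => ¬ (R x ∧ S x) := by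
  simpa only [← not_and_or] using hR.or hS

lemma IsSigma.not_bex {k n : ℕ} [Level M k] {R : (Fin n → M) → M → Prop} {t : (Fin n → M) → M}
    (ht : DefFun k t) (hR : IsSigma k fun x : Fin (n + 1) → M => ¬ R (Fin.tail x) (x 0)) :
    IsSigma k fun x => ¬ ∃ y < t x, R x y := by
  simpa using IsSigma.ball (R := fun x y => ¬ R x y) ht hR

variable [PAMinus M] [Level M 1]

/-- At place `0` the modulus of `β` is `c + 1`, so `entry s c 0` serves as the remainder of `s`
modulo `c + 1`. -/
lemma exists_eq_mul_add_entry (s c : M) :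
    entry s c 0 < c + 1 ∧ ∃ q, s = q * (c + 1) + entry s c 0 := by
  have := beta_iff.2 (rfl : entry s c 0 = _)
  rwa [Beta, zero_add, one_mul, add_comm 1 c] at this

/-- If some witnesses for places up to `c` are unboundedly large, then the codes of the places
with their least witnesses form an unbounded `Π₁` set with at most one element in each residue
class modulo `c + 1`. -/
lemma exists_unbounded_set {θ : M → M → M → Prop}
    (hθ : IsDelta 1 fun v : Fin 3 → M => θ (v 0) (v 1) (v 2)) {c : M}
    (hub : ∀ b, ∃ x < c + 1, (∃ y, ∀ z, ¬ θ x y z) ∧ ∀ y < b, ¬ ∀ z, ¬ θ x y z) :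
    ∃ D : Set M, IsSigma 1 (fun x : Fin 1 → M => ¬ x 0 ∈ D) ∧ (∀ b, ∃ s ∈ D, b ≤ s) ∧
      ∀ s ∈ D, ∀ s' ∈ D, entry s c 0 = entry s' c 0 → s = s' := by
  have hθ' : ∀ {n} {f g h : (Fin n → M) → M}, DefFun 1 f → DefFun 1 g → DefFun 1 h →
      IsDelta 1 fun x => θ (f x) (g x) (h x) := by
    intro n f g h hf hg hh
    have hF : ∀ i, DefFun 1 fun x => ![f x, g x, h x] i := fun i => by
      fin_cases i
      exacts [hf, hg, hh]
    exact ⟨hθ.1.comp hF, hθ.2.comp hF⟩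
  let B : M → M → M → Prop := fun x y m => ∀ y' < y, ∃ z < m, θ x y' z
  have hB : ∀ {n} {f g h : (Fin n → M) → M}, DefFun 1 f → DefFun 1 g → DefFun 1 h →
      IsDelta 1 fun x => B (f x) (g x) (h x) := fun hf hg hh =>
    .ball hg (.bex hh.tail (hθ' hf.tail.tail (.coord 1) (.coord 0)))
  -- "`y` is the least witness for `x`" is a conjunction of a `Π₁` and a `Σ₁` condition. Recording
  -- also the least `m ≥ y` that bounds refutations of all smaller candidates makes the second part
  -- `Δ₁`, so that `E` is `Π₁`, and still determines `m` from `x`.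
  let E : M → M → Prop := fun x m =>
    ∃ y < m + 1, (∀ z, ¬ θ x y z) ∧ B x y m ∧ ∀ m' < m, y ≤ m' → ¬ B x y m'
  have hE : IsSigma 1 fun v : Fin 2 → M => ¬ E (v 0) (v 1) := by
    refine .not_bex (.add (.coord 1) (.const 1)) (.not_and ?_ ?_)
    · have : IsSigma 1 fun v : Fin 3 → M => ∃ z, θ (v 1) (v 0) z :=
        .ex (hθ' (.coord 2) (.coord 1) (.coord 0)).1
      simp only [not_forall, not_not]
      exact this
    · exact (IsDelta.and (hB (.coord 1) (.coord 0) (.coord 2)) (.ball (.coord 2)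
        (.imp (.le (.coord 1) (.coord 0)) (hB (.coord 2) (.coord 1) (.coord 0)).not))).2
  refine ⟨{s | ∃ m < s + 1, s = m * (c + 1) + entry s c 0 ∧ E (entry s c 0) m}, ?_, ?_, ?_⟩
  · have he : DefFun 1 fun x : Fin 2 → M => entry (x 1) c 0 :=
      .entry (.coord 1) (.const c) (.const 0)
    refine .not_bex (.add (.coord 0) (.const 1)) (.not_and (IsDelta.eq (.coord 1)
      (.add (.mul (.coord 0) (.const _)) he)).2 ?_)
    exact IsSigma.comp₂ (P := fun x m => ¬ E x m) hE he (.coord 0)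
  · intro b
    obtain ⟨x, hx, hex, hb⟩ := hub b
    obtain ⟨y, hy, hmin⟩ := exists_least_of_pi (k := 1) (P := fun y => ∀ z, ¬ θ x y z) (by
      have : IsSigma 1 fun v : Fin 1 → M => ∃ z, θ x (v 0) z :=
        .ex (hθ' (.const x) (.coord 1) (.coord 0)).1
      simpa using this) hex
    obtain ⟨w, hw⟩ := sigma_collection (k := 1) (R := fun y z => θ x y z)
      (hθ' (.const x) (.coord 0) (.coord 1)).1 y fun y' hy' => by simpa using hmin y' hy'
    obtain ⟨m, ⟨hym, hm⟩, hmmin⟩ := exists_least_of_sigma (k := 1)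
      (P := fun m => y ≤ m ∧ B x y m)
      (IsDelta.and (.le (.const y) (.coord 0)) (hB (.const x) (.const y) (.coord 0))).1
      ⟨max y w, le_max_left y w, fun y' hy' => by
        obtain ⟨z, hz, h⟩ := hw y' hy'
        exact ⟨z, lt_max_of_lt_right hz, h⟩⟩
    obtain ⟨h₁, q, hq⟩ := exists_eq_mul_add_entry (m * (c + 1) + x) c
    have hms : m ≤ m * (c + 1) + x := by
      calc m ≤ m * c + m := le_add_self
        _ = m * (c + 1) := by ring
        _ ≤ _ := le_self_add
    refine ⟨m * (c + 1) + x, ⟨m, lt_succ_iff.2 hms, ?_⟩, ?_⟩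
    · rw [← (div_unique hx h₁ hq).2]
      exact ⟨rfl, y, lt_succ_iff.2 hym, hy, hm, fun m' hm' hy' h => hmmin m' hm' ⟨hy', h⟩⟩
    · refine le_trans ?_ (hym.trans hms)
      by_contra! hyb
      exact hb y hyb hy
  · rintro s ⟨m, -, hs, y, hym, hy, hm, hmin⟩ s' ⟨m', -, hs', y', hym', hy', hm', hmin'⟩ hss
    rw [← hss] at hs' hy' hm' hmin'
    have hle : ∀ {y m y' : M}, B (entry s c 0) y m → (∀ z, ¬ θ (entry s c 0) y' z) → y ≤ y' := by
      intro y m y' hB hy'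
      by_contra! h
      obtain ⟨z, -, hz⟩ := hB y' h
      exact hy' z hz
    obtain rfl := le_antisymm (hle hm hy') (hle hm' hy)
    have : m = m' := by
      refine le_antisymm ?_ ?_
      · by_contra! h
        exact hmin m' h (lt_succ_iff.1 hym') hm'
      · by_contra! h
        exact hmin' m h (lt_succ_iff.1 hym) hm
    rw [hs, hs', this]

/-- Take a `Σ₂` set that is inductive but omits `c`. If witnesses for its members up to `c` could be
found below a fixed `b`, membership there would be `Π₁`, and `Π₁` induction would reach `c`. -/
lemma exists_unbounded_set_of_not_iSigma (h : ¬ ISigma M 2) :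
    ∃ (c : M) (D : Set M), IsSigma 1 (fun x : Fin 1 → M => ¬ x 0 ∈ D) ∧ (∀ b, ∃ s ∈ D, b ≤ s) ∧
      ∀ s ∈ D, ∀ s' ∈ D, entry s c 0 = entry s' c 0 → s = s' := by
  simp only [ISigma, not_forall] at h
  obtain ⟨A, hA, h0, hs, c, hc⟩ := h
  obtain ⟨S, hS, hAS⟩ := isSigma_succ_iff.1 hA
  obtain ⟨S₀, hS₀, hSS⟩ := isSigma_succ_iff.1 hS
  let θ : M → M → M → Prop := fun x y z => S₀ (Fin.cons y fun _ => x) z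
  have hθ : IsDelta 1 fun v : Fin 3 → M => θ (v 0) (v 1) (v 2) := by
    have h₀ : IsDelta0 fun x : Fin 3 → M => ¬ S₀ (Fin.tail x) (x 0) := hS₀
    have := h₀.subst (F := fun v : Fin 3 → M => Fin.cons (v 2) (Fin.cons (v 1) fun _ => v 0))
      fun i => by
        refine Fin.cases ?_ (Fin.cases ?_ fun i => ?_) i
        · exact .coord 2
        · exact .coord 1
        · exact .coord 0
    simp only [Fin.cons_zero, Fin.tail_cons] at this
    simpa only [not_not] using this.isDelta.not
  have hmem : ∀ x, x ∈ A ↔ ∃ y, ∀ z, ¬ θ x y z := by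
    intro x
    have h₁ := congrFun hAS fun _ => x
    have h₂ : ∀ y, (¬ S (fun _ => x) y) ↔ ∃ z, θ x y z := fun y => by
      have := congrFun hSS (Fin.cons y fun _ => x)
      simpa using this
    simp only at h₁
    rw [h₁]
    refine exists_congr fun y => ?_
    rw [← not_exists, ← h₂, not_not]
  refine ⟨c, exists_unbounded_set hθ fun b => ?_⟩
  by_contra! hb
  have key : ∀ x, x < c + 1 → ∃ y < b, ∀ z, ¬ θ x y z := by
    refine pi_induction (k := 1) ?_ ?_ ?_
    · have : IsSigma 1 fun v : Fin 1 → M => v 0 < c + 1 ∧ ∀ y < b, ∃ z, θ (v 0) y z := by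
        refine .and (IsDelta.lt (.coord 0) (.const _)).1 (.ball (.const b) (.ex ?_))
        have hF : ∀ i, DefFun 1 fun v : Fin 3 → M => ![v 2, v 1, v 0] i := fun i => by
          fin_cases i
          exacts [.coord 2, .coord 1, .coord 0]
        exact hθ.1.comp hF
      simpa using this
    · exact fun hx => hb 0 hx ((hmem 0).1 h0)
    · intro x ih hx
      obtain ⟨y, -, hy⟩ := ih ((lt_add_one' x).trans hx)
      exact hb _ hx ((hmem _).1 (hs x ((hmem x).2 ⟨y, hy⟩)))
  obtain ⟨y, -, hy⟩ := key c (lt_add_one' c)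
  exact hc ((hmem c).2 ⟨y, hy⟩)

end SparseSet

/-! ### The tree of strings vanishing on a set, and the failure of density. -/

section ZeroTree

variable {M : Type u} [CommSemiring M] [LinearOrder M]

/-- The tree of the strings that vanish at all places in `Z`. -/
def zeroTree (Z : Set M) : Set M :=
  {σ | 0 < σ ∧ ∀ τ n, IsPrefix τ σ → HasLength τ (n + 1) → n ∈ Z → ∃ w, τ = 2 * w}

variable [PAMinus M] [Level M 1]

lemma IsPrefix.refl (s : M) : IsPrefix s s :=
  isPrefix_iff.2 ⟨0, 0, pw_pos 0, by simp [pw_zero]⟩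

lemma IsPrefix.trans {s t v : M} (h₁ : IsPrefix s t) (h₂ : IsPrefix t v) : IsPrefix s v := by
  obtain ⟨k, r, hr, rfl⟩ := isPrefix_iff.1 h₁
  obtain ⟨l, q, hq, rfl⟩ := isPrefix_iff.1 h₂
  refine isPrefix_iff.2 ⟨k + l, r * pw l + q, ?_, by rw [pw_add]; ring⟩
  rw [pw_add]
  calc r * pw l + q < r * pw l + pw l := by gcongr
    _ = (r + 1) * pw l := by ring
    _ ≤ _ := by have := succ_le_iff.2 hr; gcongr

lemma IsPrefix.le {s t : M} (h : IsPrefix s t) : s ≤ t := by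
  obtain ⟨k, r, -, rfl⟩ := isPrefix_iff.1 h
  exact (le_mul_of_one_le_right zero_le (one_le_pw k)).trans le_self_add

lemma IsPrefix.length_le {s t n m : M} (h : IsPrefix s t) (hs : HasLength s n)
    (ht : HasLength t m) : n ≤ m := by
  obtain ⟨k, r, hr, rfl⟩ := isPrefix_iff.1 h
  rw [ht.unique (hasLength_append hs hr)]
  exact le_self_add

lemma isPrefix_double {τ x r : M} (hr : r < 2) :
    IsPrefix τ (2 * x + r) ↔ τ = 2 * x + r ∨ IsPrefix τ x := by
  constructor
  · intro h
    obtain ⟨k, r', hr', h⟩ := isPrefix_iff.1 h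
    obtain rfl | ⟨k, rfl⟩ := eq_zero_or_succ k
    · rw [pw_zero] at hr' h
      obtain rfl : r' = 0 := le_antisymm (lt_succ_iff.1 (by simpa using hr')) zero_le
      exact Or.inl (by simpa using h.symm)
    · obtain ⟨q, r₀, hr₀, rfl⟩ := exists_div r' (two_pos : (0 : M) < 2)
      rw [pw_succ] at hr' h
      have : x * 2 + r = (τ * pw k + q) * 2 + r₀ := by
        rw [mul_comm x, h]; ring
      refine Or.inr (isPrefix_iff.2 ⟨k, q, ?_, (div_unique hr hr₀ this).1⟩)
      refine lt_of_mul_lt_mul_right (a := 2) ?_ zero_le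
      rw [mul_comm (pw k)]
      exact le_self_add.trans_lt hr'
  · rintro (rfl | h)
    · exact .refl _
    · refine h.trans (isPrefix_iff.2 ⟨0 + 1, r, ?_, ?_⟩)
      · rw [pw_succ, pw_zero]; simpa using hr
      · rw [pw_succ, pw_zero]; ring

lemma isTree_zeroTree (Z : Set M) : IsTree (zeroTree Z) :=
  ⟨fun _ ht => ht.1, fun _ _ hs hst ht => ⟨hs, fun τ n hτ => ht.2 τ n (hτ.trans hst)⟩⟩

lemma hasLength_double {x r j : M} (hx : HasLength x j) (hr : r < 2) :
    HasLength (2 * x + r) (j + 1) := by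
  have h1 : pw (1 : M) = 2 := by simpa [pw_zero] using pw_succ (0 : M)
  have := hasLength_append (k := 1) (r := r) hx (by rwa [h1])
  rwa [h1, mul_comm] at this

lemma double_mem_zeroTree {Z : Set M} {x r j : M} (hx : HasLength x j) (hr : r < 2) :
    2 * x + r ∈ zeroTree Z ↔ x ∈ zeroTree Z ∧ (j ∈ Z → ∃ w, 2 * x + r = 2 * w) := by
  have hpos : 0 < x := (pw_pos j).trans_le (hasLength_iff.1 hx).1
  have hl := hasLength_double hx hr
  constructor
  · intro h
    exact ⟨(isTree_zeroTree Z).2 x _ hpos ((isPrefix_double hr).2 (Or.inr (.refl x))) h,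
      h.2 _ j (.refl _) hl⟩
  · rintro ⟨h₁, h₂⟩
    refine ⟨(mul_pos two_pos hpos).trans_le le_self_add, fun τ n hτ hn hnZ => ?_⟩
    rcases (isPrefix_double hr).1 hτ with rfl | hτ
    · exact h₂ (add_right_cancel (hn.unique hl) ▸ hnZ)
    · exact h₁.2 τ n hτ hn hnZ

lemma even_mem_zeroTree {Z : Set M} {x j : M} (hx : HasLength x j) :
    2 * x ∈ zeroTree Z ↔ x ∈ zeroTree Z := by
  have := double_mem_zeroTree (Z := Z) hx two_pos
  simp only [add_zero] at this
  rw [this]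
  exact ⟨fun h => h.1, fun h => ⟨h, fun _ => ⟨x, rfl⟩⟩⟩

lemma odd_mem_zeroTree {Z : Set M} {x j : M} (hx : HasLength x j) :
    2 * x + 1 ∈ zeroTree Z ↔ x ∈ zeroTree Z ∧ j ∉ Z := by
  rw [double_mem_zeroTree hx one_lt_two]
  refine and_congr_right fun _ => ⟨fun h hj => ?_, fun h hj => absurd hj h⟩
  obtain ⟨w, hw⟩ := h hj
  have := (div_unique (m := 2) (q := x) (r := 1) (q' := w) (r' := 0) one_lt_two two_pos
    (by rw [mul_comm x, hw]; ring)).2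
  exact one_ne_zero this

lemma one_mem_zeroTree (Z : Set M) : 1 ∈ zeroTree Z := by
  refine ⟨one_pos, fun τ n hτ hn _ => ?_⟩
  have h1 := (hasLength_iff.1 hn).1.trans hτ.le
  rw [pw_succ] at h1
  have : (2 : M) ≤ 1 := (le_mul_of_one_le_right zero_le (one_le_pw n)).trans h1
  exact absurd this (not_le.2 one_lt_two)

/-- A string below `2^(l+1)` has length at most `l` and so sees only places below `l`. This lets a
coded initial part replace the `Π₁` set `D`. -/
lemma mem_zeroTree_congr {Z Z' : Set M} {l σ : M} (h : ∀ n < l, n ∈ Z ↔ n ∈ Z')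
    (hσ : σ < pw (l + 1)) : σ ∈ zeroTree Z ↔ σ ∈ zeroTree Z' := by
  refine and_congr_right fun hpos => ?_
  obtain ⟨m, hm⟩ := exists_hasLength hpos
  refine forall_congr' fun τ => forall_congr' fun n => forall_congr' fun hτ => forall_congr'
    fun hn => ?_
  rw [h n]
  have h₁ := lt_of_pw_lt ((hasLength_iff.1 hm).1.trans_lt hσ)
  exact succ_le_iff.1 ((hτ.length_le hn hm).trans (lt_succ_iff.1 h₁))

lemma isDelta_mem_zeroTree {n : ℕ} {f a b : (Fin n → M) → M} (hf : DefFun 1 f) (ha : DefFun 1 a)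
    (hb : DefFun 1 b) :
    IsDelta 1 fun x => f x ∈ zeroTree {i | 0 = entry (a x) (b x) i} := by
  have key : ∀ σ a b : M, σ ∈ zeroTree {i | 0 = entry a b i} ↔ 0 < σ ∧ ∀ τ < σ + 1, ∀ n < σ + 1,
      (0 < τ ∧ ∃ k < σ + 1, ∃ r < σ + 1, r < pw k ∧ σ = τ * pw k + r) →
      (pw (n + 1) ≤ τ ∧ τ < 2 * pw (n + 1)) → 0 = entry a b n → ∃ w < τ + 1, τ = 2 * w := by
    intro σ a b
    refine and_congr_right fun _ => ⟨fun h τ _ n _ hpre hl h0 => ?_, fun h τ n hpre hl h0 => ?_⟩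
    · obtain ⟨-, k, -, r, -, h'⟩ := hpre
      obtain ⟨w, rfl⟩ := h τ n (isPrefix_iff.2 ⟨k, r, h'⟩) (hasLength_iff.2 hl) h0
      exact ⟨w, lt_succ_iff.2 (le_mul_of_one_le_left zero_le one_le_two), rfl⟩
    · have hl' := hasLength_iff.1 hl
      have hτ : 0 < τ := (pw_pos _).trans_le hl'.1
      obtain ⟨k, r, hr, rfl⟩ := isPrefix_iff.1 hpre
      obtain ⟨w, -, hw⟩ := h τ (lt_succ_iff.2 hpre.le) n
        (lt_succ_iff.2 (((lt_add_one' n).trans (lt_pw _)).le.trans (hl'.1.trans hpre.le)))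
        ⟨hτ, k, lt_succ_iff.2 ((lt_pw k).le.trans ((le_mul_of_one_le_left zero_le
          (PAMinus.one_le_of_pos τ hτ)).trans le_self_add)), r, lt_succ_iff.2 le_add_self, hr, rfl⟩
        hl' h0
      exact ⟨w, hw⟩
  have hd : IsDelta 1 fun x : Fin 3 → M => x 0 ∈ zeroTree {i | 0 = entry (x 1) (x 2) i} := by
    simp only [key]
    refine .and (.lt (.const 0) (.coord 0)) (.ball (.add (.coord 0) (.const 1))
      (.ball (.add (.coord 1) (.const 1)) (.imp (.and (.lt (.const 0) (.coord 1))
        (.bex (.add (.coord 2) (.const 1)) (.bex (.add (.coord 3) (.const 1))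
          (.and (.lt (.coord 0) (.pw (.coord 1))) (.eq (.coord 4) (.add
            (.mul (.coord 3) (.pw (.coord 1))) (.coord 0))))))) (.imp (.and ?_ ?_) (.imp ?_ ?_)))))
    · exact .le (.pw (.add (.coord 0) (.const 1))) (.coord 1)
    · exact .lt (.coord 1) (.mul (.const 2) (.pw (.add (.coord 0) (.const 1))))
    · exact .eq (.const 0) (.entry (.coord 3) (.coord 4) (.coord 0))
    · exact .bex (.add (.coord 1) (.const 1)) (.eq (.coord 2) (.mul (.const 2) (.coord 0)))
  have hF : ∀ i, DefFun 1 fun x => ![f x, a x, b x] i := fun i => by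
    fin_cases i
    exacts [hf, ha, hb]
  exact ⟨hd.1.comp hF, hd.2.comp hF⟩

lemma CodesOracle.entry_eq_zero_iff {D : Set M} {a b u i : M} (h : CodesOracle Dᶜ a b u)
    (hi : i < u) : 0 = entry a b i ↔ i ∈ D := by
  rcases h i hi with ⟨h₁, h₂⟩ | ⟨h₁, h₂⟩ <;> rw [beta_iff] at h₂
  · rw [← h₂]
    exact ⟨fun h => absurd h zero_ne_one, fun h => absurd h h₁⟩
  · rw [← h₂]
    exact ⟨fun _ => not_not.1 h₁, fun _ => rfl⟩

/-- The oracle is the c.e. complement of `D`; a coded initial part of length `u` decides every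
string `x < 2^u`, in particular for `u = x`. -/
lemma isZeroJumpComputable_zeroTree {D : Set M} (hD : IsSigma 1 fun x : Fin 1 → M => ¬ x 0 ∈ D) :
    IsZeroJumpComputable (zeroTree D) := by
  have hc : ∀ {x a b u : M}, CodesOracle Dᶜ a b u → x < pw u →
      (x ∈ zeroTree {i | 0 = entry a b i} ↔ x ∈ zeroTree D) := fun {x a b u} h hx =>
    mem_zeroTree_congr (l := u) (fun n hn => h.entry_eq_zero_iff hn)
      (hx.trans_le (pw_le (lt_add_one' u).le))
  refine ⟨Dᶜ, hD, fun v => v 0 < pw (v 4) ∧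
    (v 1 = 1 ∧ v 0 ∈ zeroTree {i | 0 = entry (v 2) (v 3) i} ∨
      v 1 = 0 ∧ v 0 ∉ zeroTree {i | 0 = entry (v 2) (v 3) i}), ?_, fun x => ⟨?_, ?_⟩⟩
  · have h := isDelta_mem_zeroTree (M := M) (n := 5) (.coord 0) (.coord 2) (.coord 3)
    exact (IsDelta.and (.lt (.coord 0) (.pw (.coord 4))) (.or (.and (.eq (.coord 1) (.const 1)) h)
      (.and (.eq (.coord 1) (.const 0)) h.not))).1
  · constructor
    · intro hx
      obtain ⟨a, b, hab⟩ := exists_codesOracle (k := 1) (Y := Dᶜ) hD x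
      exact ⟨a, b, x, hab, lt_pw x, Or.inl ⟨rfl, (hc hab (lt_pw x)).2 hx⟩⟩
    · rintro ⟨a, b, u, hab, hu, ⟨-, h⟩ | ⟨h, -⟩⟩
      · exact (hc hab hu).1 h
      · exact absurd h one_ne_zero
  · constructor
    · intro hx
      obtain ⟨a, b, hab⟩ := exists_codesOracle (k := 1) (Y := Dᶜ) hD x
      exact ⟨a, b, x, hab, lt_pw x, Or.inr ⟨rfl, fun h => hx ((hc hab (lt_pw x)).1 h)⟩⟩
    · rintro ⟨a, b, u, hab, hu, ⟨h, -⟩ | ⟨-, h⟩⟩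
      · exact absurd h zero_ne_one
      · exact fun h' => h ((hc hab hu).2 h')

section LevelCount

variable {Z : Set M} {C e : M → M}

lemma Counts.zeroTree_double_of_mem (hC : DefFun 1 fun x : Fin 1 → M => C (x 0))
    (h : Counts (zeroTree Z) C) {j : M} (hj : j ∈ Z) :
    C (2 * (2 * pw j)) + C (pw j) = C (2 * pw j) + C (2 * pw j) := by
  have key : ∀ y, pw j < y ∨ C (2 * (pw j + y)) + C (pw j) = C (pw j + y) + C (2 * pw j) := by
    refine sigma_induction (k := 1) ?_ (Or.inr (by simp [add_comm])) ?_
    · exact (IsDelta.or (.lt (.const _) (.coord 0)) (.eq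
        (.add (hC.comp₁ (.mul (.const 2) (.add (.const _) (.coord 0)))) (.const _))
        (.add (hC.comp₁ (.add (.const _) (.coord 0))) (.const _)))).1
    · rintro y (hy | ih)
      · exact Or.inl (hy.trans (lt_add_one' y))
      rcases le_or_gt (pw j) y with hy | hy
      · exact Or.inl (hy.trans_lt (lt_add_one' y))
      have hx : HasLength (pw j + y) j := hasLength_iff.2 ⟨le_self_add, by rw [two_mul]; gcongr⟩
      right
      rw [← add_assoc, mul_add 2 (pw j + y), mul_one, ← one_add_one_eq_two, ← add_assoc,
        one_add_one_eq_two, h.notMem (2 * (pw j + y) + 1) fun h' => ((odd_mem_zeroTree hx).1 h').2 hj]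
      by_cases hm : pw j + y ∈ zeroTree Z
      · rw [h.mem _ ((even_mem_zeroTree hx).2 hm), h.mem _ hm, add_right_comm, ih, add_right_comm]
      · rw [h.notMem _ fun h' => hm ((even_mem_zeroTree hx).1 h'), h.notMem _ hm, ih]
  have := (key (pw j)).resolve_left (lt_irrefl _)
  rwa [← two_mul] at this

lemma Counts.zeroTree_double_of_notMem (hC : DefFun 1 fun x : Fin 1 → M => C (x 0))
    (h : Counts (zeroTree Z) C) {j : M} (hj : j ∉ Z) :
    C (2 * (2 * pw j)) + 2 * C (pw j) = 2 * C (2 * pw j) + C (2 * pw j) := by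
  have key : ∀ y, pw j < y ∨
      C (2 * (pw j + y)) + 2 * C (pw j) = 2 * C (pw j + y) + C (2 * pw j) := by
    refine sigma_induction (k := 1) ?_ (Or.inr (by simp [add_comm])) ?_
    · exact (IsDelta.or (.lt (.const _) (.coord 0)) (.eq
        (.add (hC.comp₁ (.mul (.const 2) (.add (.const _) (.coord 0)))) (.const _))
        (.add (.mul (.const 2) (hC.comp₁ (.add (.const _) (.coord 0)))) (.const _)))).1
    · rintro y (hy | ih)
      · exact Or.inl (hy.trans (lt_add_one' y))
      rcases le_or_gt (pw j) y with hy | hy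
      · exact Or.inl (hy.trans_lt (lt_add_one' y))
      have hx : HasLength (pw j + y) j := hasLength_iff.2 ⟨le_self_add, by rw [two_mul]; gcongr⟩
      right
      have e : 2 * (pw j + (y + 1)) = 2 * (pw j + y) + 1 + 1 := by ring
      rw [e, ← add_assoc]
      by_cases hm : pw j + y ∈ zeroTree Z
      · rw [h.mem _ ((odd_mem_zeroTree hx).2 ⟨hm, hj⟩), h.mem _ ((even_mem_zeroTree hx).2 hm),
          h.mem _ hm, add_right_comm, add_right_comm (C _) 1, ih]
        ring
      · rw [h.notMem _ fun h' => hm ((odd_mem_zeroTree hx).1 h').1,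
          h.notMem _ fun h' => hm ((even_mem_zeroTree hx).1 h'), h.notMem _ hm, ih]
  have := (key (pw j)).resolve_left (lt_irrefl _)
  rwa [← two_mul] at this

/-- The level size stays the same at a place in `Z` and doubles elsewhere, so level `j` loses a
factor `2` only for each of the `e j` elements of `Z` below `j`. -/
lemma Counts.pw_le_zeroTree (hC : DefFun 1 fun x : Fin 1 → M => C (x 0))
    (h : Counts (zeroTree Z) C) (he : DefFun 1 fun x : Fin 1 → M => e (x 0)) (hZ : Counts Z e)
    (j : M) : pw j + pw (e j) * C (pw j) ≤ pw (e j) * C (2 * pw j) := by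
  revert j
  refine sigma_induction (k := 1) ?_ ?_ fun j ih => ?_
  · have hp : DefFun 1 fun x : Fin 1 → M => pw (x 0) := .pw (.coord 0)
    exact (IsDelta.le (.add hp (.mul (.pw he) (hC.comp₁ hp)))
      (.mul (.pw he) (hC.comp₁ (.mul (.const 2) hp)))).1
  · rw [hZ.zero, pw_zero, mul_one, ← one_add_one_eq_two, h.mem 1 (one_mem_zeroTree Z), one_mul,
      one_mul, add_comm]
  · rw [pw_succ]
    by_cases hj : j ∈ Z
    · have hd := h.zeroTree_double_of_mem hC hj
      rw [hZ.mem j hj, pw_succ]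
      simp only [Diff.of_le, Diff.of_inj, map_add, map_mul, map_ofNat] at *
      linear_combination 2 * ih - 2 * Diff.of (pw (e j)) * hd
    · have hd := h.zeroTree_double_of_notMem hC hj
      rw [hZ.notMem j hj]
      simp only [Diff.of_le, Diff.of_inj, map_add, map_mul, map_ofNat] at *
      linear_combination 2 * ih - Diff.of (pw (e j)) * hd

end LevelCount

variable {D : Set M} {c : M}

lemma measurePos_zeroTree (hD : IsSigma 1 fun x : Fin 1 → M => ¬ x 0 ∈ D)
    (hinj : ∀ s ∈ D, ∀ s' ∈ D, entry s c 0 = entry s' c 0 → s = s') :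
    MeasurePos (zeroTree D) := by
  refine ⟨1, pw (c + 1), one_pos, pw_pos _, fun l p hp => ?_⟩
  obtain rfl := isTwoPow_iff.1 hp
  -- `D` is only `Π₁`; its coded part below `l` gives `Δ₁` sets, for which counting functions exist
  -- under `IΣ₁`.
  obtain ⟨a, b, hab⟩ := exists_codesOracle (k := 1) (Y := Dᶜ) hD l
  have hT := isDelta_mem_zeroTree (n := 1) (.coord 0) (.const a) (.const b)
  have hZ : IsDelta 1 fun x : Fin 1 → M => x 0 ∈ {i | 0 = entry a b i} :=
    .eq (.const 0) (.entry (.const a) (.const b) (.coord 0))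
  obtain ⟨C, hC, hCT⟩ := exists_counts hT
  obtain ⟨e, he, heZ⟩ := exists_counts hZ
  have hle := hCT.pw_le_zeroTree hC he heZ l
  -- Remainders modulo `c + 1` inject the part of `D` below `l` into `[0, c + 1)`.
  have hel : e l ≤ c + 1 := by
    obtain ⟨k, hk, hk'⟩ := heZ.hasAtLeast hZ.1 he (zero_le (a := l))
    rw [hk, heZ.zero, zero_add]
    have hmem : ∀ z ∈ {z | z ∈ {i | 0 = entry a b i} ∧ 0 ≤ z ∧ z < l}, z ∈ D :=
      fun z hz => (hab.entry_eq_zero_iff hz.2.2).1 hz.1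
    exact le_of_hasAtLeast_lt (hk'.map (k := 1) (f := fun z => entry z c 0)
      (.entry (.coord 0) (.const c) (.const 0)) (fun z _ => (exists_eq_mul_add_entry z c).1)
      fun x hx y hy => hinj x (hmem x hx) y (hmem y hy))
  obtain ⟨k, hk, hk'⟩ := hCT.hasAtLeast hT.1 hC (u := pw l) (v := 2 * pw l)
    (le_mul_of_one_le_left zero_le one_le_two)
  refine ⟨k, hk'.mono fun z ⟨hz, hz'⟩ => ⟨?_, hasLength_iff.2 hz'⟩, ?_⟩
  · refine (mem_zeroTree_congr (fun n hn => hab.entry_eq_zero_iff hn) ?_).1 hz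
    rw [pw_succ]; exact hz'.2
  · rw [hk, mul_add, add_comm] at hle
    rw [one_mul, mul_comm]
    exact (le_of_add_le_add_left hle).trans (by have := pw_le hel; gcongr)

lemma exists_half : ∃ F : M → M, DefFun 1 (fun x : Fin 1 → M => F (x 0)) ∧
    ∀ z, ∃ r, r < 2 ∧ z = F z * 2 + r := by
  choose F hF using fun z : M => exists_div z (two_pos : (0 : M) < 2)
  refine ⟨F, ?_, hF⟩
  have : IsSigma 1 fun x : Fin 2 → M => ∃ r, r < 2 ∧ x 1 = x 0 * 2 + r :=
    .ex (.and (IsDelta.lt (.coord 0) (.const 2)).1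
      (IsDelta.eq (.coord 2) (.add (.mul (.coord 1) (.const 2)) (.coord 0))).1)
  refine (congrArg (IsSigma 1) (funext fun x => propext ?_)).mp this
  obtain ⟨r, hr, h⟩ := hF (x 1)
  constructor
  · rintro ⟨r', hr', h'⟩
    exact (div_unique hr' hr (h'.symm.trans h)).1
  · exact fun h' => ⟨r, hr, by rw [h']; exact h⟩

/-- For a place `n + m ∈ D` with `n` the length of `σ`, the strings of length `n + m + 1` in the
tree end in `0`, so at most `2^m` of the `2^(m+1)` extensions of `σ` remain. The measure above `σ`
is thus at most `2^(-n) / 2`. -/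
lemma not_denseAt_zeroTree (hD : ∀ b, ∃ s ∈ D, b ≤ s) (σ : M) : ¬ DenseAt (zeroTree D) σ 1 2 := by
  rintro ⟨n, p, c, d, hσ, hp, hd, hlt, hm⟩
  obtain rfl := isTwoPow_iff.1 hp
  obtain ⟨s, hs, hns⟩ := hD n
  obtain ⟨m, rfl⟩ := exists_add_of_le hns
  obtain ⟨k, hk, hck⟩ := hm (n + m + 1) _ (isTwoPow_iff.2 rfl)
  obtain ⟨F, hF, hspec⟩ := exists_half (M := M)
  have hev : ∀ z ∈ level (restrict (zeroTree D) σ) (n + m + 1), z = F z * 2 := by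
    rintro z ⟨⟨hz, -⟩, hl⟩
    obtain ⟨w, hw⟩ := hz.2 z (n + m) (.refl z) hl hs
    obtain ⟨r, hr, h⟩ := hspec z
    have := (div_unique hr two_pos (h.symm.trans (by rw [hw]; ring : z = w * 2 + 0))).2
    rwa [this, add_zero] at h
  -- Deleting the final `0` is injective and maps into the `2^m` extensions of `σ` by `m` bits.
  have hkm : k ≤ pw m := by
    have := le_of_hasAtLeast_Ico (u := σ * pw m) (v := σ * pw m + pw m) le_self_add
      (hk.map (k := 1) hF ?_ fun x hx y hy hxy => by rw [hev x hx, hev y hy, hxy])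
    · rw [add_comm] at this
      exact le_of_add_le_add_left this
    · intro z hz
      have hz2 := hev z hz
      obtain ⟨⟨-, hpre⟩, hl⟩ := hz
      rcases hpre with hpre | hpre
      · have := hpre.length_le hl hσ
        exact absurd this (not_le.2 (lt_succ_iff.2 le_self_add))
      · obtain ⟨j, r, hr, h⟩ := isPrefix_iff.1 hpre
        have hj : n + m + 1 = n + j := hl.unique (h ▸ hasLength_append hσ hr)
        rw [add_assoc] at hj
        obtain rfl := add_left_cancel hj
        rw [pw_succ] at hr h
        rw [hz2] at h
        constructor
        · refine le_of_mul_le_mul_right (a := 2) ?_ two_pos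
          rw [h]
          exact (by ring : σ * pw m * 2 = σ * (2 * pw m)).le.trans le_self_add
        · refine lt_of_mul_lt_mul_right (a := 2) ?_ zero_le
          rw [h]
          calc σ * (2 * pw m) + r < σ * (2 * pw m) + 2 * pw m := by gcongr
            _ = _ := by ring
  have hfin : c * pw (n + m + 1) ≤ pw m * d := hck.trans (by gcongr)
  rw [pw_succ, pw_add] at hfin
  have hpm := pw_pos m
  simp only [Diff.of_le, Diff.of_lt, map_add, map_mul, map_ofNat, map_one, map_zero] at *
  have := mul_lt_mul_of_pos_left hlt hpm
  nlinarith

end ZeroTree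

theorem iSigma_two_of_lebesgueDensity {M : Type u} [CommSemiring M] [LinearOrder M] [PAMinus M]
    [Level M 1] (h : LebesgueDensity M) : ISigma M 2 := by
  by_contra hn
  obtain ⟨c, D, hD, hub, hinj⟩ := exists_unbounded_set_of_not_iSigma hn
  obtain ⟨σ, -, hσ⟩ := h (zeroTree D) (isTree_zeroTree D) (isZeroJumpComputable_zeroTree hD)
    (measurePos_zeroTree hD hinj) 1 2 one_pos two_pos
  exact not_denseAt_zeroTree hub σ hσ

end Arith

theorem proposition3p3 (M : Type u) [CommSemiring M] [LinearOrder M] [PAMinus M]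
    (h : Arith.ISigma M 1) : Arith.ISigma M 2 ↔ Arith.LebesgueDensity M := by
  have := Arith.level_one h
  refine ⟨fun h₂ => ?_, fun h₂ => Arith.iSigma_two_of_lebesgueDensity h₂⟩
  have := Arith.level_two h₂
  exact Arith.lebesgueDensity_of_level_two
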